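/- Let $d\ge 1$, let $\mathbf s=(s_1,\dots,s_d)$ be positive integers and, for each $j$, let $l_j(n)$ be one of $2n$, $2n+1$, $2n-1$. Put $b_n(x)=4^n\binom{2n}{n}^{-1}x^{2n}$. For each $j=1,\dots,d$ let $\succ_j$ be either $\ge$ or $>$ (chosen independently), and consider $$\Xi(\mathbf s,\mathbf l;x)=\sum_{n_1\succ_1 n_2\succ_2\cdots\succ_{d-1} n_d\succ_d 0}\frac{b_{n_1}(x)}{l_1(n_1)^{s_1}\cdots l_d(n_d)^{s_d}},$$ the sum being over nonnegative integers $n_1,\dots,n_d$. Let $x$ be a real algebraic number with $0<x\le 1$, and suppose that $\Xi(\mathbf s,\mathbf l;x)$ exists, i.e. no denominator vanishes on the summation range and the multiple series converges (its family of terms is summable). Then $\Xi(\mathbf s,\mathbf l;x)$ is a finite linear combination, with coefficients in the ring $\mathbb Q[i,x,\sqrt{1-x^2}]$, of values of multiple polylogarithms $$\mathrm{Li}_{k_1,\dots,k_r}(z_1,\dots,z_r)=\lim_{N\to\infty}\sum_{N>n_1>\cdots>n_r>0}\frac{z_1^{n_1}\cdots z_r^{n_r}}{n_1^{k_1}\cdots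 n_r^{k_r}}$$ at algebraic points, where $r\ge 0$ (the value for $r=0$ being $1$), the $k_j$ are positive integers, the $z_j$ are algebraic numbers with $|z_1\cdots z_j|\le 1$ for all $j$, and $(k_1,z_1)\ne(1,1)$ if $r\ge1$. -/

import Mathlib

noncomputable section

namespace Apery

/-- The `N`-truncated multiple polylogarithm series
`∑_{N > n₁ > ⋯ > n_r > 0} z₁^{n₁} ⋯ z_r^{n_r} / (n₁^{s₁} ⋯ n_r^{s_r})`.
For `r = 0` it is the empty product `1`. -/
def mplPartialSum {r : ℕ} (s : Fin r → ℕ) (z : Fin r → ℂ) (N : ℕ) : ℂ :=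
  open Classical in
  ∑ n ∈ (Fintype.piFinset fun _ : Fin r => Finset.Ioo 0 N).filter (fun n => StrictAnti n),
    ∏ j, z j ^ n j / (n j : ℂ) ^ s j

/-- Admissible arguments: `|z₁ ⋯ z_j| ≤ 1` for every `j`, and `(s₁, z₁) ≠ (1, 1)`. -/
def MplAdmissible {r : ℕ} (s : Fin r → ℕ) (z : Fin r → ℂ) : Prop :=
  (∀ j, 0 < s j) ∧ (∀ j, ‖∏ i ∈ Finset.Iic j, z i‖ ≤ 1) ∧
    ∀ h : 0 < r, ¬ (s ⟨0, h⟩ = 1 ∧ z ⟨0, h⟩ = 1)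

/-- The values `Li_s(z)` of multiple polylogarithms of any depth `r ≥ 0` at admissible points
`z` with algebraic coordinates; the value is the limit of the truncated series. -/
def mplAlgebraicValues : Set ℂ :=
  {v | ∃ (r : ℕ) (s : Fin r → ℕ) (z : Fin r → ℂ),
    MplAdmissible s z ∧ (∀ j, IsAlgebraic ℚ (z j)) ∧
      Filter.Tendsto (mplPartialSum s z) Filter.atTop (nhds v)}

/-- `b_n(x) = 4^n x^{2n} / binom(2n, n)`. -/
def b (n : ℕ) (x : ℝ) : ℝ := 4 ^ n / (n.centralBinom : ℝ) * x ^ (2 * n)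

/-- The index following `n_j` in the chain `n₁ ≻ n₂ ≻ ⋯ ≻ n_d ≻ 0`. -/
def nextIndex {d : ℕ} (n : Fin d → ℕ) (j : Fin d) : ℕ :=
  if h : (j : ℕ) + 1 < d then n ⟨j + 1, h⟩ else 0

/-- The summation range `n₁ ≻ n₂ ≻ ⋯ ≻ n_d ≻ 0`, where the `j`-th relation is `>` when
`strict j` holds and `≥` otherwise. -/
def indexSet {d : ℕ} (strict : Fin d → Prop) : Set (Fin d → ℕ) :=
  {n | ∀ j, nextIndex n j ≤ n j ∧ (strict j → nextIndex n j < n j)}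

/-- The general term `b_{n₁}(x) / (l₁(n₁)^{s₁} ⋯ l_d(n_d)^{s_d})`. -/
def xiTerm {d : ℕ} [NeZero d] (s : Fin d → ℕ) (l : Fin d → ℕ → ℤ) (x : ℝ)
    (n : Fin d → ℕ) : ℝ :=
  b (n 0) x / ∏ j, (l j (n j) : ℝ) ^ s j

/-- The series `Ξ(s, l; x)` exists: no denominator vanishes on the summation range, and the
multiple series converges. -/
def XiExists {d : ℕ} [NeZero d] (s : Fin d → ℕ) (l : Fin d → ℕ → ℤ) (strict : Fin d → Prop)
    (x : ℝ) : Prop :=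
  (∀ n ∈ indexSet strict, ∀ j, l j (n j) ≠ 0) ∧
    Summable fun n : indexSet strict => xiTerm s l x n

/-- The sum `Ξ(s, l; x) = ∑_{n₁ ≻ ⋯ ≻ n_d ≻ 0} b_{n₁}(x) / (l₁(n₁)^{s₁} ⋯ l_d(n_d)^{s_d})`. -/
def xi {d : ℕ} [NeZero d] (s : Fin d → ℕ) (l : Fin d → ℕ → ℤ) (strict : Fin d → Prop)
    (x : ℝ) : ℝ :=
  ∑' n : indexSet strict, xiTerm s l x n

/-- The subring `ℚ[i, x, √(1 - x²)]` of `ℂ`. -/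
def coeffRing (x : ℝ) : Subalgebra ℚ ℂ :=
  Algebra.adjoin ℚ {Complex.I, (x : ℂ), ((Real.sqrt (1 - x ^ 2) : ℝ) : ℂ)}

end Apery

end

open Filter Topology Set

noncomputable section

namespace Apery

variable {K : IntermediateField ℚ ℂ}

/-! Substitute x = 2u/(1+u²) with 0 < u < 1. Then √(1-x²) = (1-u²)/(1+u²) and dx/x =
(1-u²)du/(u(1+u²)) are rational in u. For a rational sequence a write φ_a = ∑ a_n b_n(x) (`phi`).
The Euler operator θ = x d/dx multiplies a_n by 2n. Hence dividing a_n by 2n, 2n+1 or 2n-1 means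
integrating φ_a, xφ_a or φ_a/x against dx/x and then multiplying by 1, 1/x or x (`phi_div_mem`).

Let σ_n = ∑_{m<n} a_m and g = φ_{σ/2n}. The recurrence of the numbers 4^n/binom(2n,n) gives (1-x²)θg
- g = x²φ_a. The integrating factor √(1-x²)/x turns this into d/du(√(1-x²)/x · g) = 2φ_a/(1+u²)
(`phi_partialSum_div_mem`). Every nested sum is thus obtained from a constant by iterated
integration against forms in u with poles at 0, ±1, ±i.

Combinations of hyperlogarithms with rational coefficients are closed under such integration
(`hspan_le_primSpan`, `hspanPole_le_primSpan`). The behaviour at u = 0 excludes log u and puts the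
constants of integration in the coefficient field (`mem_of_hasD_primSpan`). A hyperlogarithm at an
algebraic u is a multiple polylogarithm at algebraic points (`exists_mpl_of_isWord`), which settles
x < 1.

For x = 1 the singularity at u = 1 matters. Convergence forces s₁ ≥ 2, so the last operation is a
division by l₁. The factor 1-u² of dx/x then removes the pole at 1, and the result lies in
`hspanReg`, whose elements have limits of the required form at 1 (`exists_tendsto_of_mem_hspanReg`).
-/

/-! ### Power series with coefficients of polynomial growth. -/

/-- Sequences of at most polynomial growth. -/
def PolyBdd (p : ℕ → ℂ) : Prop :=
  ∃ (C : ℝ) (M : ℕ), ∀ n, ‖p n‖ ≤ C * ((n : ℝ) + 1) ^ M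

/-- The power series with coefficients `p` at a real point. -/
def psum (p : ℕ → ℂ) (x : ℝ) : ℂ := ∑' n, p n * (x : ℂ) ^ n

lemma summable_succ_pow_mul_geometric (M : ℕ) {r : ℝ} (h0 : 0 ≤ r) (h1 : r < 1) :
    Summable fun n : ℕ => ((n : ℝ) + 1) ^ M * r ^ n := by
  obtain ⟨ρ, hρ, hρ1⟩ := exists_between h1
  have hρ0 : 0 < ρ := h0.trans_lt hρ
  have h := summable_pow_mul_geometric_of_norm_lt_one (R := ℝ) M (r := ρ)
    (by rwa [Real.norm_of_nonneg hρ0.le])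
  have h' := ((summable_nat_add_iff 1).2 h).mul_right ρ⁻¹
  refine Summable.of_nonneg_of_le (fun n => by positivity) (fun n => ?_) h'
  have : (((n + 1 : ℕ) : ℝ) ^ M * ρ ^ (n + 1)) * ρ⁻¹ = ((n : ℝ) + 1) ^ M * ρ ^ n := by
    rw [pow_succ]
    push_cast
    field_simp
  rw [this]
  gcongr

lemma PolyBdd.exists_nonneg {p : ℕ → ℂ} (hp : PolyBdd p) :
    ∃ (C : ℝ) (M : ℕ), 0 ≤ C ∧ ∀ n, ‖p n‖ ≤ C * ((n : ℝ) + 1) ^ M := by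
  obtain ⟨C, M, h⟩ := hp
  refine ⟨C, M, ?_, h⟩
  have := (norm_nonneg _).trans (h 0)
  simpa using this

lemma PolyBdd.of_norm_le {p q : ℕ → ℂ} (hq : PolyBdd q) (h : ∀ n, ‖p n‖ ≤ ‖q n‖) :
    PolyBdd p := by
  obtain ⟨C, M, hC⟩ := hq
  exact ⟨C, M, fun n => (h n).trans (hC n)⟩

lemma PolyBdd.add {p q : ℕ → ℂ} (hp : PolyBdd p) (hq : PolyBdd q) :
    PolyBdd (fun n => p n + q n) := by
  obtain ⟨C, M, hC, h⟩ := hp.exists_nonneg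
  obtain ⟨C', M', hC', h'⟩ := hq.exists_nonneg
  refine ⟨C + C', M + M', fun n => (norm_add_le _ _).trans ?_⟩
  have h1 : (1 : ℝ) ≤ (n : ℝ) + 1 := by linarith [(Nat.cast_nonneg n : (0 : ℝ) ≤ n)]
  have a1 : ((n : ℝ) + 1) ^ M ≤ ((n : ℝ) + 1) ^ (M + M') := pow_le_pow_right₀ h1 (by omega)
  have a2 : ((n : ℝ) + 1) ^ M' ≤ ((n : ℝ) + 1) ^ (M + M') := pow_le_pow_right₀ h1 (by omega)
  have b1 := mul_le_mul_of_nonneg_left a1 hC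
  have b2 := mul_le_mul_of_nonneg_left a2 hC'
  linarith [h n, h' n]

lemma PolyBdd.mul {p q : ℕ → ℂ} (hp : PolyBdd p) (hq : PolyBdd q) :
    PolyBdd (fun n => p n * q n) := by
  obtain ⟨C, M, hC, h⟩ := hp.exists_nonneg
  obtain ⟨C', M', hC', h'⟩ := hq.exists_nonneg
  refine ⟨C * C', M + M', fun n => ?_⟩
  rw [norm_mul, pow_add]
  calc ‖p n‖ * ‖q n‖ ≤ (C * ((n : ℝ) + 1) ^ M) * (C' * ((n : ℝ) + 1) ^ M') :=
        mul_le_mul (h n) (h' n) (norm_nonneg _) (by positivity)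
    _ = _ := by ring

lemma PolyBdd.shift {p : ℕ → ℂ} (hp : PolyBdd p) : PolyBdd (fun n => p (n + 1)) := by
  obtain ⟨C, M, hC, h⟩ := hp.exists_nonneg
  refine ⟨C * 2 ^ M, M, fun n => (h (n + 1)).trans ?_⟩
  rw [mul_assoc, ← mul_pow]
  gcongr
  push_cast
  linarith [(Nat.cast_nonneg n : (0 : ℝ) ≤ n)]

lemma polyBdd_const (c : ℂ) : PolyBdd fun _ => c := ⟨‖c‖, 0, fun n => by simp⟩

lemma polyBdd_natCast : PolyBdd fun n => (n : ℂ) :=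
  ⟨1, 1, fun n => by simp⟩

lemma PolyBdd.partialSum {p : ℕ → ℂ} (hp : PolyBdd p) :
    PolyBdd (fun n => ∑ m ∈ Finset.range n, p m) := by
  obtain ⟨C, M, hC, h⟩ := hp.exists_nonneg
  refine ⟨C, M + 1, fun n => ?_⟩
  calc ‖∑ m ∈ Finset.range n, p m‖ ≤ ∑ m ∈ Finset.range n, ‖p m‖ := norm_sum_le _ _
    _ ≤ ∑ m ∈ Finset.range n, C * ((n : ℝ) + 1) ^ M := by
        refine Finset.sum_le_sum fun m hm => (h m).trans ?_
        have : (m : ℝ) ≤ n := by exact_mod_cast (Finset.mem_range.1 hm).le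
        gcongr
    _ = n * (C * ((n : ℝ) + 1) ^ M) := by simp
    _ ≤ (n + 1) * (C * ((n : ℝ) + 1) ^ M) := by gcongr; linarith
    _ = _ := by ring

lemma PolyBdd.summable_norm {p : ℕ → ℂ} (hp : PolyBdd p) {x : ℝ} (hx : |x| < 1) :
    Summable fun n => ‖p n * (x : ℂ) ^ n‖ := by
  obtain ⟨C, M, hC, h⟩ := hp.exists_nonneg
  refine Summable.of_nonneg_of_le (fun n => norm_nonneg _) (fun n => ?_)
    ((summable_succ_pow_mul_geometric M (abs_nonneg x) hx).mul_left C)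
  rw [norm_mul, norm_pow, Complex.norm_real, Real.norm_eq_abs, ← mul_assoc]
  gcongr
  exact h n

lemma PolyBdd.summable {p : ℕ → ℂ} (hp : PolyBdd p) {x : ℝ} (hx : |x| < 1) :
    Summable fun n => p n * (x : ℂ) ^ n := (hp.summable_norm hx).of_norm

lemma PolyBdd.hasSum {p : ℕ → ℂ} (hp : PolyBdd p) {x : ℝ} (hx : |x| < 1) :
    HasSum (fun n => p n * (x : ℂ) ^ n) (psum p x) := (hp.summable hx).hasSum

lemma psum_add {p q : ℕ → ℂ} (hp : PolyBdd p) (hq : PolyBdd q) {x : ℝ} (hx : |x| < 1) :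
    psum (fun n => p n + q n) x = psum p x + psum q x := by
  rw [psum, psum, psum, ← (hp.summable hx).tsum_add (hq.summable hx)]
  simp [add_mul]

lemma psum_const_mul (c : ℂ) (p : ℕ → ℂ) (x : ℝ) :
    psum (fun n => c * p n) x = c * psum p x := by
  simp_rw [psum, mul_assoc, tsum_mul_left]

lemma psum_shift {p : ℕ → ℂ} (hp : PolyBdd p) {x : ℝ} (hx : |x| < 1) :
    psum p x = p 0 + x * psum (fun n => p (n + 1)) x := by
  rw [psum, (hp.summable hx).tsum_eq_zero_add, psum, ← tsum_mul_left]
  simp only [pow_zero, mul_one, pow_succ]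
  congr 1
  exact tsum_congr fun n => by ring

lemma hasDerivAt_psum {p : ℕ → ℂ} (hp : PolyBdd p) {x : ℝ} (hx : |x| < 1) :
    HasDerivAt (psum p) (psum (fun n => ((n : ℂ) + 1) * p (n + 1)) x) x := by
  obtain ⟨C, M, hC, h⟩ := hp.exists_nonneg
  obtain ⟨ρ, hρ, hρ1⟩ := exists_between hx
  have hρ0 : 0 < ρ := (abs_nonneg x).trans_lt hρ
  have hsum : Summable fun n : ℕ => ρ⁻¹ * (C * (((n : ℝ) + 1) ^ (M + 1) * ρ ^ n)) :=
    ((summable_succ_pow_mul_geometric (M + 1) hρ0.le hρ1).mul_left C).mul_left _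
  -- Termwise differentiation on (-ρ, ρ) with |x| < ρ < 1, where one summable series dominates all
  -- derivatives.
  have key := hasDerivAt_tsum_of_isPreconnected (𝕜 := ℝ) (F := ℂ)
    (g := fun n (y : ℝ) => p n * (y : ℂ) ^ n)
    (g' := fun n (y : ℝ) => p n * (n * (y : ℂ) ^ (n - 1))) (t := Ioo (-ρ) ρ) (y₀ := 0) (y := x)
    hsum isOpen_Ioo isPreconnected_Ioo
    (fun n y _ => ((hasDerivAt_pow n (y : ℂ)).comp_ofReal).const_mul (p n))
    (fun n y hy => ?_) ⟨by linarith, hρ0⟩ (hp.summable (by simp)) (abs_lt.1 hρ)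
  · have e : ∑' n, p n * (n * (x : ℂ) ^ (n - 1)) =
        psum (fun n => ((n : ℂ) + 1) * p (n + 1)) x := by
      have hs : Summable fun n => p n * (n * (x : ℂ) ^ (n - 1)) := by
        rw [← summable_nat_add_iff 1]
        have := (((polyBdd_natCast.add (polyBdd_const 1)).mul hp.shift)).summable hx
        refine this.congr fun n => ?_
        simp only [Nat.add_sub_cancel]
        push_cast
        ring
      rw [hs.tsum_eq_zero_add]
      simp only [Nat.cast_zero, zero_mul, mul_zero, zero_add, psum]
      refine tsum_congr fun n => ?_
      simp only [Nat.add_sub_cancel]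
      push_cast
      ring
    rw [← e]
    exact key
  · have hy' : |y| ≤ ρ := (abs_lt.2 hy).le
    rw [norm_mul, norm_mul, norm_pow, Complex.norm_real, Real.norm_eq_abs, Complex.norm_natCast]
    rcases n with _ | n
    · simp; positivity
    · simp only [Nat.add_sub_cancel]
      calc ‖p (n + 1)‖ * (((n + 1 : ℕ) : ℝ) * |y| ^ n)
          ≤ (C * (((n + 1 : ℕ) : ℝ) + 1) ^ M) * ((((n + 1 : ℕ) : ℝ) + 1) * ρ ^ n) := by
            gcongr
            · exact h _
            · linarith
        _ = _ := by rw [pow_succ ρ, pow_succ _ M]; field_simp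

lemma continuousAt_psum {p : ℕ → ℂ} (hp : PolyBdd p) {x : ℝ} (hx : |x| < 1) :
    ContinuousAt (psum p) x := (hasDerivAt_psum hp hx).continuousAt

/-! ### Differentiation of functions on the open unit interval. -/

/-- Complex functions on the open unit interval. -/
abbrev Fn := Ioo (0 : ℝ) 1 → ℂ

/-- Extension by zero. -/
def extendFn (f : Fn) : ℝ → ℂ := Function.extend Subtype.val f 0

lemma extendFn_coe (f : Fn) (u : Ioo (0 : ℝ) 1) : extendFn f u = f u :=
  Subtype.val_injective.extend_apply f 0 u

/-- `g` is the derivative of `f` on the open unit interval. -/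
def HasD (f g : Fn) : Prop := ∀ u : Ioo (0 : ℝ) 1, HasDerivAt (extendFn f) (g u) u

/-- The interval is open, so the values of `extendFn` outside it do not influence derivatives at its
points. -/
lemma hasD_of_hasDerivAt {f g : Fn} (F : ℝ → ℂ) (hf : ∀ u, f u = F u)
    (h : ∀ u : Ioo (0 : ℝ) 1, HasDerivAt F (g u) u) : HasD f g := by
  intro u
  refine (h u).congr_of_eventuallyEq ?_
  filter_upwards [isOpen_Ioo.mem_nhds u.2] with t ht
  rw [← hf ⟨t, ht⟩]
  exact extendFn_coe f ⟨t, ht⟩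

lemma HasD.add {f f' g g' : Fn} (hf : HasD f f') (hg : HasD g g') : HasD (f + g) (f' + g') :=
  hasD_of_hasDerivAt (fun t => extendFn f t + extendFn g t)
    (fun u => by simp [extendFn_coe]) fun u => (hf u).add (hg u)

lemma HasD.sub {f f' g g' : Fn} (hf : HasD f f') (hg : HasD g g') : HasD (f - g) (f' - g') :=
  hasD_of_hasDerivAt (fun t => extendFn f t - extendFn g t)
    (fun u => by simp [extendFn_coe]) fun u => (hf u).sub (hg u)

lemma HasD.mul {f f' g g' : Fn} (hf : HasD f f') (hg : HasD g g') :
    HasD (f * g) (f' * g + f * g') :=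
  hasD_of_hasDerivAt (fun t => extendFn f t * extendFn g t)
    (fun u => by simp [extendFn_coe]) fun u => by
      have := (hf u).mul (hg u)
      rw [extendFn_coe, extendFn_coe] at this
      exact this

lemma hasD_const (c : ℂ) : HasD (fun _ => c) 0 :=
  hasD_of_hasDerivAt (fun _ => c) (fun _ => rfl) fun _ => hasDerivAt_const _ _

lemma HasD.const_mul {f f' : Fn} (c : ℂ) (hf : HasD f f') :
    HasD (fun u => c * f u) (fun u => c * f' u) :=
  hasD_of_hasDerivAt (fun t => c * extendFn f t)
    (fun u => by simp [extendFn_coe]) fun u => (hf u).const_mul c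

lemma HasD.congr {f f' g' : Fn} (hf : HasD f f') (h : f' = g') : HasD f g' := h ▸ hf

lemma HasD.eq_const {f : Fn} (hf : HasD f 0) : ∃ c, ∀ u, f u = c := by
  have := isOpen_Ioo.exists_is_const_of_deriv_eq_zero (𝕜 := ℝ) (f := extendFn f)
    (s := Ioo (0 : ℝ) 1) isPreconnected_Ioo
    (fun u hu => (hf ⟨u, hu⟩).differentiableAt.differentiableWithinAt)
    (fun u hu => (hf ⟨u, hu⟩).deriv)
  obtain ⟨c, hc⟩ := this
  exact ⟨c, fun u => by rw [← extendFn_coe f u]; exact hc _ u.2⟩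

/-! ### Hyperlogarithms and their derivatives. -/

/-- Taylor coefficients of the hyperlogarithm of a word; `(k, a)` stands for the letter `a`
preceded by `k` letters `0`. -/
def hcoef : List (ℕ × ℂ) → ℕ → ℂ
  | [], n => if n = 0 then 1 else 0
  | q :: w, n => (∑ m ∈ Finset.range n, hcoef w m * q.2 ^ m) * q.2⁻¹ ^ n / (n : ℂ) ^ (q.1 + 1)

/-- The letters lie in `K` and have absolute value one. -/
def IsWord (K : IntermediateField ℚ ℂ) (w : List (ℕ × ℂ)) : Prop :=
  ∀ q ∈ w, q.2 ∈ K ∧ ‖q.2‖ = 1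

/-- The hyperlogarithm of a word on the open unit interval. -/
def hlog (w : List (ℕ × ℂ)) : Fn := fun u => psum (hcoef w) u


lemma IsWord.tail {q : ℕ × ℂ} {w : List (ℕ × ℂ)} (h : IsWord K (q :: w)) : IsWord K w :=
  fun p hp => h p (List.mem_cons_of_mem _ hp)

lemma IsWord.cons {k : ℕ} {a : ℂ} {w : List (ℕ × ℂ)} (ha : a ∈ K) (ha' : ‖a‖ = 1)
    (h : IsWord K w) : IsWord K ((k, a) :: w) := by
  intro p hp
  rcases List.mem_cons.1 hp with rfl | hp
  · exact ⟨ha, ha'⟩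
  · exact h p hp

lemma hcoef_cons_zero (q : ℕ × ℂ) (w : List (ℕ × ℂ)) : hcoef (q :: w) 0 = 0 := by
  simp [hcoef]

lemma norm_hcoef_le {w : List (ℕ × ℂ)} (hw : IsWord K w) (n : ℕ) : ‖hcoef w n‖ ≤ 1 := by
  induction w generalizing n with
  | nil => simp only [hcoef]; split_ifs <;> simp
  | cons q w ih =>
    rcases n.eq_zero_or_pos with rfl | hn
    · simp [hcoef_cons_zero]
    have hq := (hw q (by simp)).2
    have hn' : (1 : ℝ) ≤ n := by exact_mod_cast hn
    rw [hcoef, norm_div, norm_mul, norm_pow, norm_inv, hq, inv_one, one_pow, mul_one, norm_pow,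
      Complex.norm_natCast]
    refine div_le_one_of_le₀ ?_ (by positivity)
    calc ‖∑ m ∈ Finset.range n, hcoef w m * q.2 ^ m‖
        ≤ ∑ m ∈ Finset.range n, (1 : ℝ) := by
          refine norm_sum_le_of_le _ fun m _ => ?_
          rw [norm_mul, norm_pow, hq, one_pow, mul_one]
          exact ih hw.tail m
      _ = (n : ℝ) ^ 1 := by simp
      _ ≤ _ := pow_le_pow_right₀ hn' (by omega)

lemma polyBdd_hcoef {w : List (ℕ × ℂ)} (hw : IsWord K w) : PolyBdd (hcoef w) :=
  ⟨1, 0, fun n => by simpa using norm_hcoef_le hw n⟩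

lemma abs_coe_lt_one (u : Ioo (0 : ℝ) 1) : |(u : ℝ)| < 1 := by
  rw [abs_of_pos u.2.1]; exact u.2.2

lemma coe_ne_zero (u : Ioo (0 : ℝ) 1) : ((u : ℝ) : ℂ) ≠ 0 := by
  exact_mod_cast u.2.1.ne'

lemma coe_ne_of_norm_eq_one (u : Ioo (0 : ℝ) 1) {a : ℂ} (ha : ‖a‖ = 1) : ((u : ℝ) : ℂ) ≠ a := by
  rintro rfl
  rw [Complex.norm_real, Real.norm_eq_abs] at ha
  exact (abs_coe_lt_one u).ne ha

/-- The function `u ↦ u`. -/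
def X : Fn := fun u => ((u : ℝ) : ℂ)

/-- The function `u ↦ 1 / (u - p)`. -/
def pole (p : ℂ) : Fn := fun u => (((u : ℝ) : ℂ) - p)⁻¹

lemma hlog_nil : hlog [] = 1 := by
  funext u
  rw [hlog, psum, tsum_eq_single 0 (fun n hn => by simp [hcoef, hn])]
  simp [hcoef]

lemma hasD_hlog {w : List (ℕ × ℂ)} (hw : IsWord K w) :
    HasD (hlog w) (fun u => psum (fun n => ((n : ℂ) + 1) * hcoef w (n + 1)) u) :=
  hasD_of_hasDerivAt (psum (hcoef w)) (fun _ => rfl) fun u =>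
    hasDerivAt_psum (polyBdd_hcoef hw) (abs_coe_lt_one u)

/-- Differentiation multiplies the n-th coefficient by n and so lowers the exponent of n by one; the
constant term vanishes, so dividing by u is harmless. -/
lemma hasD_hlog_succ {k : ℕ} {a : ℂ} {w : List (ℕ × ℂ)} (hw : IsWord K ((k, a) :: w)) :
    HasD (hlog ((k + 1, a) :: w)) (pole 0 * hlog ((k, a) :: w)) := by
  have ha := hw (k, a) (by simp)
  refine (hasD_hlog (K := K) (IsWord.cons ha.1 ha.2 hw.tail)).congr ?_
  funext u
  have hu := coe_ne_zero u
  rw [Pi.mul_apply, hlog, psum_shift (polyBdd_hcoef hw) (abs_coe_lt_one u), hcoef_cons_zero,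
    zero_add, pole, sub_zero, inv_mul_cancel_left₀ hu]
  congr 1
  funext n
  have hn : ((n : ℂ) + 1) ≠ 0 := by exact_mod_cast n.succ_ne_zero
  simp only [hcoef]
  push_cast
  rw [pow_succ _ (k + 1)]
  field_simp

/-- Here the factor n cancels the whole denominator. What remains is the Cauchy product of `hcoef w`
with the geometric series of 1/(a-u). -/
lemma hasD_hlog_zero {a : ℂ} {w : List (ℕ × ℂ)} (hw : IsWord K ((0, a) :: w)) :
    HasD (hlog ((0, a) :: w)) (-(pole a * hlog w)) := by
  have ha := hw (0, a) (by simp)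
  simp only at ha
  have ha0 : a ≠ 0 := by
    rintro rfl
    simp at ha
  refine (hasD_hlog hw).congr ?_
  funext u
  have hu1 := abs_coe_lt_one u
  set e : ℕ → ℂ := fun n => ((n : ℂ) + 1) * hcoef ((0, a) :: w) (n + 1) with he
  have hee : ∀ n, e n = (∑ m ∈ Finset.range (n + 1), hcoef w m * a ^ m) * a⁻¹ ^ (n + 1) := by
    intro n
    have hn : ((n : ℂ) + 1) ≠ 0 := by exact_mod_cast n.succ_ne_zero
    simp only [he, hcoef, zero_add, pow_one]
    push_cast
    field_simp
  have hew : PolyBdd e :=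
    (polyBdd_natCast.add (polyBdd_const 1)).mul (polyBdd_hcoef hw).shift
  have h0 : a * e 0 = hcoef w 0 := by
    rw [hee]; simp; field_simp
  -- Together with `h0`, this is the identity (a-u)·∑ e_n uⁿ = `hlog w` read off on coefficients.
  have h1 : ∀ n, a * e (n + 1) = e n + hcoef w (n + 1) := by
    intro n
    rw [hee, hee, Finset.sum_range_succ _ (n + 1)]
    simp only [inv_pow, pow_succ _ (n + 1)]
    field_simp
  have s1 := psum_shift hew hu1
  have s2 := psum_shift (polyBdd_hcoef hw.tail) hu1
  have s3 : a * psum (fun n => e (n + 1)) u =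
      psum e u + psum (fun n => hcoef w (n + 1)) u := by
    rw [← psum_const_mul, ← psum_add hew (polyBdd_hcoef hw.tail).shift hu1]
    simp_rw [h1]
  have hua : ((u : ℝ) : ℂ) - a ≠ 0 := sub_ne_zero.2 (coe_ne_of_norm_eq_one u ha.2)
  simp only [Pi.neg_apply, Pi.mul_apply, hlog, pole]
  rw [eq_neg_iff_add_eq_zero]
  field_simp
  linear_combination (-a) * s1 + s2 - (u : ℂ) * s3 - h0

/-! ### Rational functions and partial fractions. -/

/-- The admissible poles. -/
def poleSet (K : IntermediateField ℚ ℂ) : Set ℂ := {p | p ∈ K ∧ (p = 0 ∨ ‖p‖ = 1 ∧ p ≠ 1)}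

/-- Rational functions with admissible poles. -/
def regRing (K : IntermediateField ℚ ℂ) : Subalgebra K Fn :=
  Algebra.adjoin K ({X} ∪ pole '' poleSet K)

lemma X_mem : X ∈ regRing K := Algebra.subset_adjoin (Or.inl rfl)

lemma pole_mem {p : ℂ} (hp : p ∈ poleSet K) : pole p ∈ regRing K :=
  Algebra.subset_adjoin (Or.inr ⟨p, hp, rfl⟩)

lemma zero_mem_poleSet : (0 : ℂ) ∈ poleSet K := ⟨K.zero_mem, Or.inl rfl⟩

/-- The constant function. -/
def cst (c : ℂ) : Fn := fun _ => c

lemma cst_mem {c : ℂ} (hc : c ∈ K) : cst c ∈ regRing K :=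
  (regRing K).algebraMap_mem ⟨c, hc⟩

lemma cst_mul_mem (S : Submodule K Fn) {c : ℂ} (hc : c ∈ K) {f : Fn} (hf : f ∈ S) :
    cst c * f ∈ S := S.smul_mem (⟨c, hc⟩ : K) hf

lemma smul_eq_cst_mul (c : K) (f : Fn) : c • f = cst (c : ℂ) * f := rfl

lemma pole_ne {p : ℂ} (hp : p ∈ poleSet K) (u : Ioo (0 : ℝ) 1) : ((u : ℝ) : ℂ) - p ≠ 0 := by
  rcases hp.2 with rfl | h
  · simpa using coe_ne_zero u
  · exact sub_ne_zero.2 (coe_ne_of_norm_eq_one u h.1)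

lemma X_mul_pole {p : ℂ} (hp : p ∈ poleSet K) : X * pole p = 1 + cst p * pole p := by
  funext u
  have := pole_ne hp u
  simp only [X, pole, cst, Pi.mul_apply, Pi.add_apply, Pi.one_apply]
  field_simp
  ring

lemma pole_mul_pole {p q : ℂ} (hp : p ∈ poleSet K) (hq : q ∈ poleSet K) (h : p ≠ q) :
    pole p * pole q = cst (p - q)⁻¹ * (pole p - pole q) := by
  funext u
  have := pole_ne hp u
  have := pole_ne hq u
  have := sub_ne_zero.2 h
  simp only [pole, cst, Pi.mul_apply, Pi.sub_apply]
  field_simp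
  ring

/-- Monomials and powers of simple fractions. -/
def fracBasis (K : IntermediateField ℚ ℂ) : Set Fn :=
  {f | ∃ k : ℕ, f = X ^ k} ∪ {f | ∃ p ∈ poleSet K, ∃ k : ℕ, f = pole p ^ (k + 1)}

lemma X_pow_mem_span (k : ℕ) : X ^ k ∈ Submodule.span K (fracBasis K) :=
  Submodule.subset_span (Or.inl ⟨k, rfl⟩)

lemma pole_pow_mem_span {p : ℂ} (hp : p ∈ poleSet K) (k : ℕ) :
    pole p ^ k ∈ Submodule.span K (fracBasis K) := by
  rcases k with _ | k
  · simpa using X_pow_mem_span 0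
  · exact Submodule.subset_span (Or.inr ⟨p, hp, k, rfl⟩)

lemma pole_mul_X_pow {p : ℂ} (hp : p ∈ poleSet K) (k : ℕ) :
    pole p * X ^ k ∈ Submodule.span K (fracBasis K) := by
  induction k with
  | zero => simpa using pole_pow_mem_span hp 1
  | succ k ih =>
    have : pole p * X ^ (k + 1) = X ^ k + cst p * (pole p * X ^ k) := by
      linear_combination X ^ k * X_mul_pole hp
    rw [this]
    exact add_mem (X_pow_mem_span k) (cst_mul_mem _ hp.1 ih)

lemma pole_mul_pole_pow {p q : ℂ} (hp : p ∈ poleSet K) (hq : q ∈ poleSet K) (k : ℕ) :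
    pole p * pole q ^ k ∈ Submodule.span K (fracBasis K) := by
  rcases eq_or_ne p q with rfl | h
  · rw [← pow_succ']
    exact pole_pow_mem_span hp _
  induction k with
  | zero => simpa using pole_pow_mem_span hp 1
  | succ k ih =>
    have : pole p * pole q ^ (k + 1) =
        cst (p - q)⁻¹ * (pole p * pole q ^ k - pole q ^ (k + 1)) := by
      linear_combination pole q ^ k * pole_mul_pole hp hq h
    rw [this]
    exact cst_mul_mem _ (inv_mem (sub_mem hp.1 hq.1)) (sub_mem ih (pole_pow_mem_span hq _))

lemma X_mul_pole_pow {p : ℂ} (hp : p ∈ poleSet K) (k : ℕ) :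
    X * pole p ^ (k + 1) ∈ Submodule.span K (fracBasis K) := by
  have : X * pole p ^ (k + 1) = pole p ^ k + cst p * pole p ^ (k + 1) := by
    linear_combination pole p ^ k * X_mul_pole hp
  rw [this]
  exact add_mem (pole_pow_mem_span hp _) (cst_mul_mem _ hp.1 (pole_pow_mem_span hp _))

lemma mul_mem_span_fracBasis {g f : Fn} (hg : g ∈ ({X} ∪ pole '' poleSet K : Set Fn))
    (hf : f ∈ Submodule.span K (fracBasis K)) : g * f ∈ Submodule.span K (fracBasis K) := by
  induction hf using Submodule.span_induction with
  | zero => simp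
  | add x y _ _ hx hy => rw [mul_add]; exact add_mem hx hy
  | smul c x _ hx => rw [mul_smul_comm]; exact Submodule.smul_mem _ c hx
  | mem x hx =>
    rcases hg with rfl | ⟨p, hp, rfl⟩ <;> rcases hx with ⟨k, rfl⟩ | ⟨q, hq, k, rfl⟩
    · rw [← pow_succ']; exact X_pow_mem_span _
    · exact X_mul_pole_pow hq k
    · exact pole_mul_X_pow hp k
    · exact pole_mul_pole_pow hp hq _

/-- Partial fraction decomposition: the span of the basis contains 1 and is stable under
multiplication by the generators. -/
lemma regRing_le_span : Subalgebra.toSubmodule (regRing K) ≤ Submodule.span K (fracBasis K) := by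
  rw [regRing, Algebra.adjoin_eq_span, Submodule.span_le]
  intro f hf
  induction hf using Submonoid.closure_induction_left with
  | one => simpa using X_pow_mem_span (K := K) 0
  | mul_left g hg f _ ih => exact mul_mem_span_fracBasis hg ih

/-- Modulo `u - 1` a regular rational function is a constant. -/
lemma exists_eq_const_add {r : Fn} (hr : r ∈ regRing K) :
    ∃ c ∈ K, ∃ q ∈ regRing K, r = cst c + (X - 1) * q := by
  induction hr using Algebra.adjoin_induction with
  | mem x hx =>
    rcases hx with rfl | ⟨p, hp, rfl⟩
    · exact ⟨1, K.one_mem, 1, one_mem _, by funext u; simp [X, cst]⟩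
    · have h1 : 1 - p ≠ 0 := by
        rcases hp.2 with rfl | h
        · simp
        · exact sub_ne_zero.2 h.2.symm
      have h1K : (1 - p)⁻¹ ∈ K := inv_mem (sub_mem K.one_mem hp.1)
      refine ⟨(1 - p)⁻¹, h1K, -(cst (1 - p)⁻¹ * pole p),
        neg_mem (mul_mem (cst_mem h1K) (pole_mem hp)), ?_⟩
      funext u
      have := pole_ne hp u
      simp only [pole, cst, X, Pi.mul_apply, Pi.sub_apply, Pi.add_apply, Pi.neg_apply,
        Pi.one_apply]
      field_simp
      ring
  | algebraMap c => exact ⟨c, c.2, 0, zero_mem _, by simp; rfl⟩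
  | add x y _ _ hx hy =>
    obtain ⟨c, hc, q, hq, rfl⟩ := hx
    obtain ⟨c', hc', q', hq', rfl⟩ := hy
    refine ⟨c + c', add_mem hc hc', q + q', add_mem hq hq', ?_⟩
    have : cst (c + c') = cst c + cst c' := rfl
    rw [this]; ring
  | mul x y hx0 hy0 hx hy =>
    obtain ⟨c, hc, q, hq, rfl⟩ := hx
    obtain ⟨c', hc', q', hq', rfl⟩ := hy
    refine ⟨c * c', mul_mem hc hc', cst c * q' + q * (cst c' + (X - 1) * q'),
      add_mem (mul_mem (cst_mem hc) hq') (mul_mem hq hy0), ?_⟩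
    have : cst (c * c') = cst c * cst c' := rfl
    rw [this]; ring

lemma hasD_X : HasD X 1 :=
  hasD_of_hasDerivAt (fun t => (t : ℂ)) (fun _ => rfl) fun _ => Complex.ofRealCLM.hasDerivAt

lemma hasD_pole {p : ℂ} (hp : p ∈ poleSet K) : HasD (pole p) (-(pole p) ^ 2) := by
  refine hasD_of_hasDerivAt (fun t => ((t : ℂ) - p)⁻¹) (fun _ => rfl) fun u => ?_
  have h : HasDerivAt (fun t : ℝ => (t : ℂ) - p) 1 u :=
    Complex.ofRealCLM.hasDerivAt.sub_const p
  have h' := h.fun_inv (pole_ne hp u)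
  rwa [neg_div, one_div, ← inv_pow] at h'

lemma HasD.pow {f f' : Fn} (hf : HasD f f') (n : ℕ) :
    HasD (f ^ (n + 1)) (cst (n + 1) * f ^ n * f') := by
  induction n with
  | zero => simpa using hf.congr (by funext; simp [cst])
  | succ n ih =>
    rw [pow_succ]
    refine (ih.mul hf).congr ?_
    funext u
    simp only [cst, Pi.mul_apply, Pi.add_apply, Pi.pow_apply]
    push_cast
    ring

/-- Partial fraction integration: modulo simple fractions, every regular rational function is the
derivative of one that vanishes at `1`. -/
lemma exists_primitive_regRing {r : Fn} (hr : r ∈ regRing K) :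
    ∃ q ∈ regRing K, ∃ l ∈ Submodule.span K (pole '' poleSet K),
      HasD ((X - 1) * q) (r - l) := by
  have key : ∃ q ∈ regRing K, ∃ l ∈ Submodule.span K (pole '' poleSet K), HasD q (r - l) := by
    have hr' := regRing_le_span hr
    clear hr
    induction hr' using Submodule.span_induction with
    | zero => exact ⟨0, zero_mem _, 0, zero_mem _, by rw [sub_self]; exact hasD_const 0⟩
    | add x y _ _ hx hy =>
      obtain ⟨q, hq, l, hl, h⟩ := hx
      obtain ⟨q', hq', l', hl', h'⟩ := hy
      exact ⟨q + q', add_mem hq hq', l + l', add_mem hl hl', (h.add h').congr (by ring)⟩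
    | smul c x _ hx =>
      obtain ⟨q, hq, l, hl, h⟩ := hx
      refine ⟨c • q, Subalgebra.smul_mem _ hq c, c • l, Submodule.smul_mem _ c hl, ?_⟩
      refine (h.const_mul c).congr ?_
      rw [← smul_sub]
      rfl
    | mem x hx =>
      rcases hx with ⟨k, rfl⟩ | ⟨p, hp, k, rfl⟩
      · have hk : ((k : ℂ) + 1) ≠ 0 := by exact_mod_cast k.succ_ne_zero
        have hkK : ((k : ℂ) + 1)⁻¹ ∈ K := inv_mem (add_mem (natCast_mem K k) K.one_mem)
        refine ⟨cst ((k : ℂ) + 1)⁻¹ * X ^ (k + 1), mul_mem (cst_mem hkK) (pow_mem X_mem _), 0,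
          zero_mem _, ((hasD_X.pow k).const_mul ((k : ℂ) + 1)⁻¹).congr ?_⟩
        funext u
        simp only [cst, Pi.mul_apply, Pi.sub_apply, Pi.pow_apply, Pi.one_apply, Pi.zero_apply]
        field_simp
        ring
      · rcases k with _ | k
        · exact ⟨0, zero_mem _, pole p, Submodule.subset_span ⟨p, hp, rfl⟩,
            by rw [zero_add, pow_one, sub_self]; exact hasD_const 0⟩
        · have hk : ((k : ℂ) + 1) ≠ 0 := by exact_mod_cast k.succ_ne_zero
          have hkK : -((k : ℂ) + 1)⁻¹ ∈ K :=
            neg_mem (inv_mem (add_mem (natCast_mem K k) K.one_mem))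
          refine ⟨cst (-((k : ℂ) + 1)⁻¹) * pole p ^ (k + 1),
            mul_mem (cst_mem hkK) (pow_mem (pole_mem hp) _), 0,
            zero_mem _, (((hasD_pole hp).pow k).const_mul (-((k : ℂ) + 1)⁻¹)).congr ?_⟩
          funext u
          simp only [cst, Pi.mul_apply, Pi.sub_apply, Pi.pow_apply, Pi.neg_apply, Pi.zero_apply]
          field_simp
          ring
  obtain ⟨q, hq, l, hl, h⟩ := key
  -- The free constant of integration is spent on making the primitive divisible by u - 1.
  obtain ⟨c, hc, q', hq', e⟩ := exists_eq_const_add hq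
  refine ⟨q', hq', l, hl, ?_⟩
  have : (X - 1) * q' = q - cst c := by rw [e]; ring
  rw [this]
  exact (h.sub (hasD_const c)).congr (sub_zero _)

/-! ### Primitives of combinations of hyperlogarithms. -/

/-- Hyperlogarithms with regular rational coefficients. -/
def hspan (K : IntermediateField ℚ ℂ) : Submodule K Fn :=
  Submodule.span K {f | ∃ r ∈ regRing K, ∃ w, IsWord K w ∧ f = r * hlog w}

/-- The combinations of hyperlogarithms that stay finite at `1`: the words that start with the
letter `1` come with a coefficient that vanishes at `1`. -/
def hspanReg (K : IntermediateField ℚ ℂ) : Submodule K Fn :=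
  Submodule.span K
    ({f | ∃ r ∈ regRing K, ∃ w, IsWord K w ∧ (∀ v, w ≠ (0, 1) :: v) ∧ f = r * hlog w} ∪
      {f | ∃ r ∈ regRing K, ∃ w, IsWord K w ∧ f = (X - 1) * r * hlog w})

lemma mul_hlog_mem_hspan {r : Fn} (hr : r ∈ regRing K) {w : List (ℕ × ℂ)} (hw : IsWord K w) :
    r * hlog w ∈ hspan K := Submodule.subset_span ⟨r, hr, w, hw, rfl⟩

lemma mul_hlog_mem_hspanReg {r : Fn} (hr : r ∈ regRing K) {w : List (ℕ × ℂ)} (hw : IsWord K w)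
    (h : ∀ v, w ≠ (0, 1) :: v) : r * hlog w ∈ hspanReg K :=
  Submodule.subset_span (Or.inl ⟨r, hr, w, hw, h, rfl⟩)

lemma sub_one_mul_hlog_mem_hspanReg {r : Fn} (hr : r ∈ regRing K) {w : List (ℕ × ℂ)}
    (hw : IsWord K w) : (X - 1) * r * hlog w ∈ hspanReg K :=
  Submodule.subset_span (Or.inr ⟨r, hr, w, hw, rfl⟩)

lemma hspanReg_le_hspan : hspanReg K ≤ hspan K := by
  refine Submodule.span_le.2 ?_
  rintro _ (⟨r, hr, w, hw, -, rfl⟩ | ⟨r, hr, w, hw, rfl⟩)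
  · exact mul_hlog_mem_hspan hr hw
  · exact mul_hlog_mem_hspan (mul_mem (sub_mem (X_mem (K := K)) (one_mem _)) hr) hw

lemma mul_mem_hspan {r f : Fn} (hr : r ∈ regRing K) (hf : f ∈ hspan K) : r * f ∈ hspan K := by
  induction hf using Submodule.span_induction with
  | zero => simp
  | add x y _ _ hx hy => rw [mul_add]; exact add_mem hx hy
  | smul c x _ hx => rw [mul_smul_comm]; exact Submodule.smul_mem _ c hx
  | mem x hx =>
    obtain ⟨s, hs, w, hw, rfl⟩ := hx
    rw [← mul_assoc]
    exact mul_hlog_mem_hspan (mul_mem hr hs) hw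

lemma mul_mem_hspanReg {r f : Fn} (hr : r ∈ regRing K) (hf : f ∈ hspanReg K) :
    r * f ∈ hspanReg K := by
  induction hf using Submodule.span_induction with
  | zero => simp
  | add x y _ _ hx hy => rw [mul_add]; exact add_mem hx hy
  | smul c x _ hx => rw [mul_smul_comm]; exact Submodule.smul_mem _ c hx
  | mem x hx =>
    rcases hx with ⟨s, hs, w, hw, h, rfl⟩ | ⟨s, hs, w, hw, rfl⟩
    · rw [← mul_assoc]
      exact mul_hlog_mem_hspanReg (mul_mem hr hs) hw h
    · have : r * ((X - 1) * s * hlog w) = (X - 1) * (r * s) * hlog w := by ring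
      rw [this]
      exact sub_one_mul_hlog_mem_hspanReg (mul_mem hr hs) hw

lemma isWord_nil : IsWord K [] := by simp [IsWord]

lemma cst_mem_hspanReg {c : ℂ} (hc : c ∈ K) : cst c ∈ hspanReg K := by
  have := mul_hlog_mem_hspanReg (cst_mem hc) (isWord_nil (K := K)) (by simp)
  rwa [hlog_nil, mul_one] at this

/-- The functions that have, up to a multiple of `1 / u`, a primitive in `S`. -/
def primSpan (S : Submodule K Fn) : Submodule K Fn where
  carrier := {f | ∃ q ∈ S, ∃ c ∈ K, HasD q (f - cst c * pole 0)}
  zero_mem' := ⟨0, S.zero_mem, 0, K.zero_mem, (hasD_const 0).congr (by funext; simp [cst])⟩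
  add_mem' := by
    rintro f g ⟨q, hq, c, hc, h⟩ ⟨q', hq', c', hc', h'⟩
    refine ⟨q + q', add_mem hq hq', c + c', add_mem hc hc', (h.add h').congr ?_⟩
    have : cst (c + c') = cst c + cst c' := rfl
    rw [this]; ring
  smul_mem' := by
    rintro k f ⟨q, hq, c, hc, h⟩
    refine ⟨k • q, S.smul_mem k hq, k * c, mul_mem k.2 hc, (h.const_mul k).congr ?_⟩
    have : cst (k * c) = cst k * cst c := rfl
    rw [this, smul_eq_cst_mul]
    funext u
    simp only [cst, Pi.sub_apply, Pi.mul_apply]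
    ring

lemma primSpan_mono {S T : Submodule K Fn} (h : S ≤ T) : primSpan S ≤ primSpan T := by
  rintro f ⟨q, hq, hf⟩
  exact ⟨q, h hq, hf⟩

lemma mem_primSpan {S : Submodule K Fn} {q f : Fn} (hq : q ∈ S) (h : HasD q f) :
    f ∈ primSpan S :=
  ⟨q, hq, 0, K.zero_mem, h.congr (by funext; simp [cst])⟩

/-- Integration against 1/(u-p) prepends the letter p. The one exception is 1/u times the empty
word: its primitive log u is not available, which is why `primSpan` allows a multiple of 1/u. -/
lemma pole_mul_hlog_mem_primSpan {p : ℂ} (hp : p ∈ poleSet K) {w : List (ℕ × ℂ)}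
    (hw : IsWord K w) : pole p * hlog w ∈ primSpan (hspanReg K) := by
  rcases hp.2 with rfl | h
  · rcases w with _ | ⟨⟨k, a⟩, w⟩
    · refine ⟨0, zero_mem _, 1, K.one_mem, (hasD_const 0).congr ?_⟩
      rw [hlog_nil]
      funext u
      simp [cst]
    · have ha := hw (k, a) (by simp)
      have hw' : IsWord K ((k + 1, a) :: w) := IsWord.cons ha.1 ha.2 hw.tail
      have hm := mul_hlog_mem_hspanReg (one_mem (regRing K)) hw' (by simp)
      rw [one_mul] at hm
      exact mem_primSpan hm (hasD_hlog_succ hw)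
  · have hw' : IsWord K ((0, p) :: w) := IsWord.cons hp.1 h.1 hw
    have hm := mul_hlog_mem_hspanReg (one_mem (regRing K)) hw' (by simp [h.2])
    rw [one_mul] at hm
    have := neg_mem (mem_primSpan hm (hasD_hlog_zero hw'))
    rwa [neg_neg] at this

/-- Integration by parts. The boundary term carries the factor u - 1, so it lies in `hspanReg` even
if `w` starts with the letter 1; `H` handles the remaining integral. -/
lemma mul_hlog_mem_primSpan_of_hasD {w : List (ℕ × ℂ)} (hw : IsWord K w) {d : Fn}
    (hd : HasD (hlog w) d)
    (H : ∀ q ∈ regRing K, (X - 1) * q * d ∈ primSpan (hspanReg K)) {r : Fn}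
    (hr : r ∈ regRing K) : r * hlog w ∈ primSpan (hspanReg K) := by
  obtain ⟨q, hq, l, hl, h⟩ := exists_primitive_regRing hr
  have h1 : (r - l) * hlog w + (X - 1) * q * d ∈ primSpan (hspanReg K) :=
    mem_primSpan (sub_one_mul_hlog_mem_hspanReg hq hw) (h.mul hd)
  have h2 : l * hlog w ∈ primSpan (hspanReg K) := by
    clear h h1
    induction hl using Submodule.span_induction with
    | zero => simp
    | add x y _ _ hx hy => rw [add_mul]; exact add_mem hx hy
    | smul c x _ hx => rw [smul_mul_assoc]; exact Submodule.smul_mem _ c hx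
    | mem x hx =>
      obtain ⟨p, hp, rfl⟩ := hx
      exact pole_mul_hlog_mem_primSpan hp hw
  have : r * hlog w = ((r - l) * hlog w + (X - 1) * q * d) - (X - 1) * q * d + l * hlog w := by
    ring
  rw [this]
  exact add_mem (sub_mem h1 (H q hq)) h2

lemma sub_one_mul_pole_one : (X - 1) * pole 1 = 1 := by
  funext u
  have : ((u : ℝ) : ℂ) - 1 ≠ 0 := sub_ne_zero.2 (coe_ne_of_norm_eq_one u (by simp))
  simp [X, pole, this]

/-- Induction on the number of letters, since differentiation removes the first one. If that letter
is 1, its pole lies outside `regRing` and is cancelled by the factor u - 1. -/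
lemma mul_hlog_mem_primSpan {w : List (ℕ × ℂ)} (hw : IsWord K w) {r : Fn} (hr : r ∈ regRing K) :
    r * hlog w ∈ primSpan (hspanReg K) := by
  induction w generalizing r with
  | nil =>
    refine mul_hlog_mem_primSpan_of_hasD hw (d := 0) (by rw [hlog_nil]; exact hasD_const 1) ?_ hr
    intro q _
    simp
  | cons x w ih =>
    obtain ⟨k, a⟩ := x
    have ha := hw (k, a) (by simp)
    simp only at ha
    induction k generalizing r with
    | zero =>
      refine mul_hlog_mem_primSpan_of_hasD hw (hasD_hlog_zero hw) (fun q hq => ?_) hr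
      by_cases h1 : a = 1
      · subst h1
        have : (X - 1) * q * -(pole 1 * hlog w) = -(q * hlog w) := by
          linear_combination (-q * hlog w) * sub_one_mul_pole_one
        rw [this]
        exact neg_mem (ih hw.tail hq)
      · have : (X - 1) * q * -(pole a * hlog w) = -((X - 1) * q * pole a) * hlog w := by ring
        rw [this]
        exact ih hw.tail (neg_mem (mul_mem (mul_mem (sub_mem X_mem (one_mem _)) hq)
          (pole_mem ⟨ha.1, Or.inr ⟨ha.2, h1⟩⟩)))
    | succ k ihk =>
      have hw' : IsWord K ((k, a) :: w) := IsWord.cons ha.1 ha.2 hw.tail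
      refine mul_hlog_mem_primSpan_of_hasD hw (hasD_hlog_succ hw') (fun q hq => ?_) hr
      rw [← mul_assoc]
      exact ihk (mul_mem (mul_mem (sub_mem X_mem (one_mem _)) hq) (pole_mem zero_mem_poleSet))
        hw'

lemma hspan_le_primSpan : hspan K ≤ primSpan (hspanReg K) := by
  refine Submodule.span_le.2 ?_
  rintro _ ⟨r, hr, w, hw, rfl⟩
  exact mul_hlog_mem_primSpan hw hr

/-- Combinations of hyperlogarithms whose coefficients may have a simple pole at `1`. -/
def hspanPole (K : IntermediateField ℚ ℂ) : Submodule K Fn where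
  carrier := {f | (X - 1) * f ∈ hspan K}
  zero_mem' := by simp
  add_mem' := by
    intro f g hf hg
    simp only [Set.mem_ofPred_eq, mul_add] at *
    exact add_mem hf hg
  smul_mem' := by
    intro c f hf
    simp only [Set.mem_ofPred_eq, mul_smul_comm] at *
    exact Submodule.smul_mem _ c hf

lemma mem_hspanPole {f : Fn} : f ∈ hspanPole K ↔ (X - 1) * f ∈ hspan K := Iff.rfl

lemma hspan_le_hspanPole : hspan K ≤ hspanPole K := fun _ hf =>
  mul_mem_hspan (sub_mem X_mem (one_mem _)) hf

lemma mul_mem_hspanPole {r f : Fn} (hr : r ∈ regRing K) (hf : f ∈ hspanPole K) :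
    r * f ∈ hspanPole K := by
  rw [mem_hspanPole, mul_left_comm]
  exact mul_mem_hspan hr hf

/-- Write the coefficient as c + (u-1)q. Only c/(u-1) is singular at 1; it prepends the letter 1
with a coefficient not vanishing there, so the primitive lies in `hspan` but need not lie in
`hspanReg`. -/
lemma hspanPole_le_primSpan : hspanPole K ≤ primSpan (hspan K) := by
  intro f hf
  have key : ∀ g ∈ hspan K, pole 1 * g ∈ primSpan (hspan K) := by
    intro g hg
    induction hg using Submodule.span_induction with
    | zero => simp
    | add x y _ _ hx hy => rw [mul_add]; exact add_mem hx hy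
    | smul c x _ hx => rw [mul_smul_comm]; exact Submodule.smul_mem _ c hx
    | mem x hx =>
      obtain ⟨s, hs, w, hw, rfl⟩ := hx
      obtain ⟨c, hc, q, hq, rfl⟩ := exists_eq_const_add hs
      have e : pole 1 * ((cst c + (X - 1) * q) * hlog w) =
          cst c * (pole 1 * hlog w) + q * hlog w := by
        linear_combination (q * hlog w) * sub_one_mul_pole_one
      rw [e]
      refine add_mem (cst_mul_mem _ hc ?_)
        (primSpan_mono hspanReg_le_hspan (mul_hlog_mem_primSpan hw hq))
      have hw' : IsWord K ((0, 1) :: w) := IsWord.cons K.one_mem (by simp) hw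
      have hm := mul_hlog_mem_hspan (one_mem (regRing K)) hw'
      rw [one_mul] at hm
      have := neg_mem (mem_primSpan hm (hasD_hlog_zero hw'))
      rwa [neg_neg] at this
  have e : f = pole 1 * ((X - 1) * f) := by
    linear_combination -f * sub_one_mul_pole_one
  rw [e]
  exact key _ hf

/-! ### Behaviour at the origin and constants of integration. -/

/-- Power series on the unit interval with coefficients in `K` of polynomial growth. -/
def IsPS (K : IntermediateField ℚ ℂ) (f : Fn) : Prop :=
  ∃ p : ℕ → ℂ, PolyBdd p ∧ (∀ n, p n ∈ K) ∧ ∀ u : Ioo (0 : ℝ) 1, f u = psum p u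

lemma IsPS.add {f g : Fn} (hf : IsPS K f) (hg : IsPS K g) : IsPS K (f + g) := by
  obtain ⟨p, hp, hpK, h⟩ := hf
  obtain ⟨q, hq, hqK, h'⟩ := hg
  exact ⟨_, hp.add hq, fun n => add_mem (hpK n) (hqK n), fun u => by
    rw [psum_add hp hq (abs_coe_lt_one u), Pi.add_apply, h, h']⟩

lemma IsPS.mul {f g : Fn} (hf : IsPS K f) (hg : IsPS K g) : IsPS K (f * g) := by
  obtain ⟨p, hp, hpK, h⟩ := hf
  obtain ⟨q, hq, hqK, h'⟩ := hg
  refine ⟨fun n => ∑ ij ∈ Finset.HasAntidiagonal.antidiagonal n, p ij.1 * q ij.2, ?_,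
    fun n => sum_mem fun ij _ => mul_mem (hpK _) (hqK _), fun u => ?_⟩
  · obtain ⟨C, M, hC, hb⟩ := hp.exists_nonneg
    obtain ⟨C', M', hC', hb'⟩ := hq.exists_nonneg
    refine ⟨C * C', M + M' + 1, fun n => ?_⟩
    calc ‖∑ ij ∈ Finset.HasAntidiagonal.antidiagonal n, p ij.1 * q ij.2‖
        ≤ ∑ ij ∈ Finset.HasAntidiagonal.antidiagonal n,
            (C * ((n : ℝ) + 1) ^ M) * (C' * ((n : ℝ) + 1) ^ M') := by
          refine norm_sum_le_of_le _ fun ij hij => ?_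
          have := Finset.HasAntidiagonal.mem_antidiagonal.1 hij
          have h1 : (ij.1 : ℝ) ≤ n := by exact_mod_cast (by omega : ij.1 ≤ n)
          have h2 : (ij.2 : ℝ) ≤ n := by exact_mod_cast (by omega : ij.2 ≤ n)
          rw [norm_mul]
          exact mul_le_mul ((hb _).trans (by gcongr)) ((hb' _).trans (by gcongr))
            (norm_nonneg _) (by positivity)
      _ = C * C' * ((n : ℝ) + 1) ^ (M + M' + 1) := by
          rw [Finset.sum_const, Finset.Nat.card_antidiagonal, nsmul_eq_mul]
          push_cast
          ring
  · rw [Pi.mul_apply, h, h', psum, psum,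
      tsum_mul_tsum_eq_tsum_sum_antidiagonal_of_summable_norm
        (hp.summable_norm (abs_coe_lt_one u)) (hq.summable_norm (abs_coe_lt_one u)), psum]
    refine tsum_congr fun n => ?_
    rw [Finset.sum_mul]
    refine Finset.sum_congr rfl fun ij hij => ?_
    rw [← Finset.HasAntidiagonal.mem_antidiagonal.1 hij, pow_add]
    ring

lemma isPS_cst {c : ℂ} (hc : c ∈ K) : IsPS K (cst c) := by
  refine ⟨fun n => if n = 0 then c else 0, ⟨‖c‖, 0, fun n => ?_⟩, fun n => ?_, fun u => ?_⟩
  · dsimp only; split_ifs <;> simp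
  · dsimp only; split_ifs
    · exact hc
    · exact K.zero_mem
  · rw [psum, tsum_eq_single 0 (fun n hn => by simp [hn])]
    simp [cst]

lemma isPS_X : IsPS K X := by
  refine ⟨fun n => if n = 1 then 1 else 0, ⟨1, 0, fun n => ?_⟩, fun n => ?_, fun u => ?_⟩
  · dsimp only; split_ifs <;> simp
  · dsimp only; split_ifs
    · exact K.one_mem
    · exact K.zero_mem
  · rw [psum, tsum_eq_single 1 (fun n hn => by simp [hn])]
    simp [X]

lemma IsPS.X_pow_mul {f : Fn} (hf : IsPS K f) (N : ℕ) : IsPS K (X ^ N * f) := by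
  induction N with
  | zero => simpa using hf
  | succ N ih => rw [pow_succ', mul_assoc]; exact isPS_X.mul ih

lemma hcoef_mem {w : List (ℕ × ℂ)} (hw : IsWord K w) (n : ℕ) : hcoef w n ∈ K := by
  induction w generalizing n with
  | nil =>
    simp only [hcoef]; split_ifs
    · exact K.one_mem
    · exact K.zero_mem
  | cons q w ih =>
    have hq := (hw q (by simp)).1
    exact div_mem (mul_mem (sum_mem fun m _ => mul_mem (ih hw.tail m) (pow_mem hq m))
      (pow_mem (inv_mem hq) n)) (pow_mem (natCast_mem K n) _)

lemma isPS_hlog {w : List (ℕ × ℂ)} (hw : IsWord K w) : IsPS K (hlog w) :=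
  ⟨hcoef w, polyBdd_hcoef hw, hcoef_mem hw, fun _ => rfl⟩

lemma isPS_pole {p : ℂ} (hp : p ∈ K) (h : ‖p‖ = 1) : IsPS K (pole p) := by
  have hp0 : p ≠ 0 := by rintro rfl; simp at h
  refine ⟨fun n => -p⁻¹ * p⁻¹ ^ n, ⟨1, 0, fun n => by simp [h]⟩,
    fun n => mul_mem (neg_mem (inv_mem hp)) (pow_mem (inv_mem hp) n), fun u => ?_⟩
  have hu : ‖p⁻¹ * ((u : ℝ) : ℂ)‖ < 1 := by
    rw [norm_mul, norm_inv, h, Complex.norm_real]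
    simpa using abs_coe_lt_one u
  have := sub_ne_zero.2 (coe_ne_of_norm_eq_one u h)
  have h2 := sub_ne_zero.2 (coe_ne_of_norm_eq_one u h).symm
  rw [psum]
  simp_rw [mul_assoc, ← mul_pow, tsum_mul_left]
  rw [tsum_geometric_of_norm_lt_one hu, pole]
  have h3 : 1 - p⁻¹ * ((u : ℝ) : ℂ) = p⁻¹ * (p - u) := by field_simp
  rw [h3]
  field_simp
  ring

/-- Finite pole at the origin, with Laurent coefficients in `K`. -/
def IsLaurent (K : IntermediateField ℚ ℂ) (f : Fn) : Prop := ∃ N, IsPS K (X ^ N * f)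

lemma IsPS.isLaurent {f : Fn} (hf : IsPS K f) : IsLaurent K f := ⟨0, by simpa using hf⟩

lemma IsLaurent.add {f g : Fn} (hf : IsLaurent K f) (hg : IsLaurent K g) :
    IsLaurent K (f + g) := by
  obtain ⟨N, hN⟩ := hf
  obtain ⟨M, hM⟩ := hg
  refine ⟨N + M, ?_⟩
  have : X ^ (N + M) * (f + g) = X ^ M * (X ^ N * f) + X ^ N * (X ^ M * g) := by ring
  rw [this]
  exact (hN.X_pow_mul M).add (hM.X_pow_mul N)

lemma IsLaurent.mul {f g : Fn} (hf : IsLaurent K f) (hg : IsLaurent K g) :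
    IsLaurent K (f * g) := by
  obtain ⟨N, hN⟩ := hf
  obtain ⟨M, hM⟩ := hg
  refine ⟨N + M, ?_⟩
  have : X ^ (N + M) * (f * g) = (X ^ N * f) * (X ^ M * g) := by ring
  rw [this]
  exact hN.mul hM

lemma isLaurent_of_mem_regRing {r : Fn} (hr : r ∈ regRing K) : IsLaurent K r := by
  induction hr using Algebra.adjoin_induction with
  | mem x hx =>
    rcases hx with rfl | ⟨p, hp, rfl⟩
    · exact isPS_X.isLaurent
    · rcases hp.2 with rfl | h
      · refine ⟨1, ?_⟩
        rw [pow_one, X_mul_pole hp]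
        convert isPS_cst K.one_mem using 1
        funext; simp [cst]
      · exact (isPS_pole hp.1 h.1).isLaurent
  | algebraMap c => exact (isPS_cst c.2).isLaurent
  | add x y _ _ hx hy => exact hx.add hy
  | mul x y _ _ hx hy => exact hx.mul hy

/-- No logarithm appears at the origin because the last letter of a word is never 0. -/
lemma isLaurent_of_mem_hspan {f : Fn} (hf : f ∈ hspan K) : IsLaurent K f := by
  induction hf using Submodule.span_induction with
  | zero => exact (isPS_cst K.zero_mem).isLaurent
  | add x y _ _ hx hy => exact hx.add hy
  | smul c x _ hx => exact (isPS_cst c.2).isLaurent.mul hx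
  | mem x hx =>
    obtain ⟨s, hs, w, hw, rfl⟩ := hx
    exact (isLaurent_of_mem_regRing hs).mul (isPS_hlog hw).isLaurent

/-- The filter of neighbourhoods of an end point of the unit interval. -/
def nearEnd (e : ℝ) : Filter (Ioo (0 : ℝ) 1) := comap Subtype.val (𝓝[Ioo 0 1] e)

instance : (nearEnd 0).NeBot := by
  have : (𝓝[Ioo (0 : ℝ) 1] 0).NeBot := by
    rw [← mem_closure_iff_nhdsWithin_neBot, closure_Ioo zero_ne_one]
    simp
  exact comap_coe_neBot_of_le_principal inf_le_right

instance : (nearEnd 1).NeBot := by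
  have : (𝓝[Ioo (0 : ℝ) 1] 1).NeBot := by
    rw [← mem_closure_iff_nhdsWithin_neBot, closure_Ioo zero_ne_one]
    simp
  exact comap_coe_neBot_of_le_principal inf_le_right

lemma tendsto_coe_nearEnd (e : ℝ) :
    Tendsto (Subtype.val : Ioo (0 : ℝ) 1 → ℝ) (nearEnd e) (𝓝[Ioo 0 1] e) := tendsto_comap

lemma tendsto_nearEnd {α : Type*} [TopologicalSpace α] {F : ℝ → α} {e : ℝ}
    (h : ContinuousAt F e) :
    Tendsto (fun u : Ioo (0 : ℝ) 1 => F u) (nearEnd e) (𝓝 (F e)) :=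
  h.tendsto.comp ((tendsto_coe_nearEnd e).mono_right nhdsWithin_le_nhds)

lemma tendsto_X_nearEnd (e : ℝ) : Tendsto X (nearEnd e) (𝓝 (e : ℂ)) :=
  tendsto_nearEnd Complex.continuous_ofReal.continuousAt

/-- A function with a finite limit at the origin that differs from a Laurent series by
`c log u + C` has `c = 0`, and `C` lies in the coefficient field. -/
lemma log_coeff_eq_zero {f : Fn} {f0 c C : ℂ} (hf : Tendsto f (nearEnd 0) (𝓝 f0)) (hf0 : f0 ∈ K)
    (N : ℕ) (h : IsPS K (X ^ N * (f - fun u : Ioo (0 : ℝ) 1 => c * (Real.log u : ℂ) + C))) : c = 0 ∧ C ∈ K := by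
  induction N with
  | zero =>
    obtain ⟨p, hp, hpK, h⟩ := h
    have h1 : Tendsto (fun u : Ioo (0 : ℝ) 1 => psum p u) (nearEnd 0) (𝓝 (p 0)) := by
      have := tendsto_nearEnd (continuousAt_psum hp (x := 0) (by simp))
      rwa [psum_shift hp (by simp), Complex.ofReal_zero, zero_mul, add_zero] at this
    have h2 : Tendsto (fun u : Ioo (0 : ℝ) 1 => c * (Real.log u : ℂ)) (nearEnd 0)
        (𝓝 (f0 - p 0 - C)) := by
      refine ((hf.sub h1).sub_const C).congr fun u => ?_
      rw [← h u]
      simp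
    have hc : c = 0 := by
      by_contra hc
      have h3 : Tendsto (fun u : Ioo (0 : ℝ) 1 => ‖c‖ * |Real.log u|) (nearEnd 0) atTop := by
        refine Tendsto.const_mul_atTop (norm_pos_iff.2 hc) (tendsto_abs_atBot_atTop.comp ?_)
        exact Real.tendsto_log_nhdsGT_zero.comp ((tendsto_coe_nearEnd 0).mono_right
          (nhdsWithin_mono _ Ioo_subset_Ioi_self))
      refine not_tendsto_nhds_of_tendsto_atTop h3 _ (h2.norm.congr fun u => ?_)
      rw [norm_mul, Complex.norm_real, Real.norm_eq_abs]
    refine ⟨hc, ?_⟩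
    subst hc
    have h4 : (0 : ℂ) = f0 - p 0 - C :=
      tendsto_nhds_unique (by simp) h2
    have : C = f0 - p 0 := by linear_combination h4
    rw [this]
    exact sub_mem hf0 (hpK 0)
  | succ N ih =>
    obtain ⟨p, hp, hpK, h⟩ := h
    have h1 : Tendsto (fun u : Ioo (0 : ℝ) 1 => psum p u) (nearEnd 0) (𝓝 (p 0)) := by
      have := tendsto_nearEnd (continuousAt_psum hp (x := 0) (by simp))
      rwa [psum_shift hp (by simp), Complex.ofReal_zero, zero_mul, add_zero] at this
    have hX : Tendsto X (nearEnd 0) (𝓝 0) := by simpa only [Complex.ofReal_zero] using tendsto_X_nearEnd 0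
    have h2 : Tendsto (fun u : Ioo (0 : ℝ) 1 => X u * (Real.log u : ℂ)) (nearEnd 0) (𝓝 0) := by
      have := tendsto_nearEnd (e := 0)
        (Complex.continuous_ofReal.comp Real.continuous_mul_log).continuousAt
      simpa [X] using this
    have h3 : Tendsto (fun u : Ioo (0 : ℝ) 1 => X u * (f u - (c * (Real.log u : ℂ) + C))) (nearEnd 0) (𝓝 0) := by
      have := ((hX.mul hf).sub (h2.const_mul c)).sub (hX.mul_const C)
      simp only [zero_mul, mul_zero, sub_zero] at this
      exact this.congr fun u => by ring
    have h4 : Tendsto (fun u : Ioo (0 : ℝ) 1 => psum p u) (nearEnd 0) (𝓝 ((0 : ℂ) ^ N * 0)) := by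
      refine ((hX.pow N).mul h3).congr fun u => ?_
      rw [← h u]
      simp only [Pi.mul_apply, Pi.pow_apply, Pi.sub_apply]
      ring
    -- Since u(f - c log u - C) tends to 0, the power series has no constant term and one factor u
    -- can be cancelled.
    have hp0 : p 0 = 0 := by
      have := tendsto_nhds_unique h1 h4
      rwa [mul_zero] at this
    refine ih ⟨fun n => p (n + 1), hp.shift, fun n => hpK _, fun u => ?_⟩
    have e := h u
    rw [psum_shift hp (abs_coe_lt_one u), hp0, zero_add] at e
    refine mul_left_cancel₀ (coe_ne_zero u) ?_
    rw [← e]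
    simp only [Pi.mul_apply, Pi.pow_apply, Pi.sub_apply, X]
    ring

/-- Both f and q + c log u are primitives of g, so they differ by a constant C. Comparison at the
origin gives c = 0 and C ∈ K; the latter is why Laurent coefficients are tracked in K. -/
lemma mem_of_hasD_primSpan {S : Submodule K Fn} (hS : S ≤ hspan K)
    (hc : ∀ c ∈ K, cst c ∈ S) {f g : Fn} {f0 : ℂ} (h : HasD f g) (hg : g ∈ primSpan S)
    (hf : Tendsto f (nearEnd 0) (𝓝 f0)) (hf0 : f0 ∈ K) : f ∈ S := by
  obtain ⟨q, hq, c, hcK, hqd⟩ := hg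
  have hlogd : HasD (fun u => c * (Real.log u : ℂ)) (cst c * pole 0) := by
    refine hasD_of_hasDerivAt (fun t => c * (Real.log t : ℂ)) (fun _ => rfl) fun u => ?_
    have := ((Real.hasDerivAt_log u.2.1.ne').ofReal_comp).const_mul c
    simpa [cst, pole] using this
  obtain ⟨C, hC⟩ := HasD.eq_const (((h.sub hqd).sub hlogd).congr (by ring))
  have hqe : q = f - fun u : Ioo (0 : ℝ) 1 => c * (Real.log u : ℂ) + C := by
    funext u
    have := hC u
    simp only [Pi.sub_apply] at this ⊢
    linear_combination -this
  obtain ⟨N, hN⟩ := isLaurent_of_mem_hspan (hS hq)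
  rw [hqe] at hN
  obtain ⟨rfl, hCK⟩ := log_coeff_eq_zero hf hf0 N hN
  have : f = q + cst C := by
    rw [hqe]; funext u; simp [cst]
  rw [this]
  exact add_mem hq (hc C hCK)

lemma mem_hspanReg_of_hasD {f g : Fn} {f0 : ℂ} (h : HasD f g) (hg : g ∈ hspan K)
    (hf : Tendsto f (nearEnd 0) (𝓝 f0)) (hf0 : f0 ∈ K) : f ∈ hspanReg K :=
  mem_of_hasD_primSpan hspanReg_le_hspan (fun _ => cst_mem_hspanReg) h (hspan_le_primSpan hg)
    hf hf0

lemma mem_hspan_of_hasD {f g : Fn} {f0 : ℂ} (h : HasD f g) (hg : g ∈ hspanPole K)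
    (hf : Tendsto f (nearEnd 0) (𝓝 f0)) (hf0 : f0 ∈ K) : f ∈ hspan K :=
  mem_of_hasD_primSpan le_rfl (fun _ hc => hspanReg_le_hspan (cst_mem_hspanReg hc)) h
    (hspanPole_le_primSpan hg) hf hf0

/-! ### The series φ_a under the substitution x = 2u/(1+u²). -/

/-- The numbers `4^n / binom(2n, n)`. -/
def bcoef (n : ℕ) : ℂ := 4 ^ n / (n.centralBinom : ℂ)

lemma bcoef_zero : bcoef 0 = 1 := by simp [bcoef]

lemma bcoef_succ (n : ℕ) : bcoef (n + 1) * (2 * n + 1) = bcoef n * (2 * n + 2) := by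
  have h := congrArg (Nat.cast (R := ℂ)) (Nat.succ_mul_centralBinom_succ n)
  have h1 : (n.centralBinom : ℂ) ≠ 0 := by exact_mod_cast n.centralBinom_ne_zero
  have h2 : ((n + 1).centralBinom : ℂ) ≠ 0 := by exact_mod_cast (n + 1).centralBinom_ne_zero
  push_cast at h
  rw [bcoef, bcoef]
  field_simp
  rw [pow_succ]
  linear_combination (-2 * 4 ^ n) * h

lemma polyBdd_bcoef : PolyBdd bcoef := by
  refine ⟨2, 1, fun n => ?_⟩
  rcases n.eq_zero_or_pos with rfl | hn
  · simp [bcoef]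
  have h := Nat.four_pow_le_two_mul_self_mul_centralBinom n hn
  have h1 : (0 : ℝ) < n.centralBinom := by exact_mod_cast n.centralBinom_pos
  rw [bcoef, norm_div, norm_pow, Complex.norm_natCast, div_le_iff₀ h1]
  have h' : (4 : ℝ) ^ n ≤ 2 * n * n.centralBinom := by exact_mod_cast h
  simp only [Complex.norm_ofNat, pow_one]
  nlinarith

/-- The substitution `x = 2u / (1 + u²)`. -/
def xval (u : ℝ) : ℝ := 2 * u / (1 + u ^ 2)

lemma one_add_sq_ne_zero (u : ℝ) : 1 + u ^ 2 ≠ 0 := by positivity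

lemma xval_pos (u : Ioo (0 : ℝ) 1) : 0 < xval u := by
  have := u.2.1
  rw [xval]; positivity

lemma xval_lt_one (u : Ioo (0 : ℝ) 1) : xval u < 1 := by
  have := u.2.2
  rw [xval, div_lt_one (by positivity)]
  nlinarith [mul_pos (sub_pos.2 this) (sub_pos.2 this)]

lemma abs_xval_sq_lt_one (u : Ioo (0 : ℝ) 1) : |xval u ^ 2| < 1 := by
  rw [abs_of_nonneg (sq_nonneg _)]
  exact pow_lt_one₀ (xval_pos u).le (xval_lt_one u) two_ne_zero

lemma continuous_xval : Continuous xval := by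
  unfold xval
  exact (by fun_prop : Continuous fun u : ℝ => 2 * u).div (by fun_prop) one_add_sq_ne_zero

lemma hasDerivAt_xval (u : ℝ) : HasDerivAt xval (2 * (1 - u ^ 2) / (1 + u ^ 2) ^ 2) u := by
  have h1 : HasDerivAt (fun u : ℝ => 2 * u) 2 u := by simpa using (hasDerivAt_id u).const_mul 2
  have h2 : HasDerivAt (fun u : ℝ => 1 + u ^ 2) (2 * u) u := by
    simpa using (hasDerivAt_pow 2 u).const_add 1
  refine (h1.fun_div h2 (one_add_sq_ne_zero u)).congr_deriv ?_
  ring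

/-- The series `∑ aₙ bₙ(x)` as a function of `u`. -/
def phi (a : ℕ → ℚ) : Fn := fun u => psum (fun n => (a n : ℂ) * bcoef n) (xval u ^ 2)

/-- Rational sequences of polynomial growth. -/
def RatBdd (a : ℕ → ℚ) : Prop := PolyBdd fun n => (a n : ℂ)

lemma RatBdd.mul_bcoef {a : ℕ → ℚ} (ha : RatBdd a) : PolyBdd fun n => (a n : ℂ) * bcoef n :=
  PolyBdd.mul ha polyBdd_bcoef

lemma RatBdd.add {a b : ℕ → ℚ} (ha : RatBdd a) (hb : RatBdd b) :
    RatBdd (fun n => a n + b n) := by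
  have := PolyBdd.add ha hb
  simpa [RatBdd] using this

lemma RatBdd.natCast_mul {a : ℕ → ℚ} (ha : RatBdd a) : RatBdd (fun n => 2 * n * a n) := by
  have := ((polyBdd_const 2).mul polyBdd_natCast).mul ha
  simpa [RatBdd] using this

lemma RatBdd.neg {a : ℕ → ℚ} (ha : RatBdd a) : RatBdd (fun n => -a n) :=
  PolyBdd.of_norm_le ha fun n => by simp

lemma RatBdd.partialSum {a : ℕ → ℚ} (ha : RatBdd a) :
    RatBdd (fun n => ∑ m ∈ Finset.range n, a m) := by
  have := PolyBdd.partialSum ha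
  simpa [RatBdd] using this

lemma RatBdd.div {a : ℕ → ℚ} (ha : RatBdd a) (l : ℕ → ℤ) : RatBdd (fun n => a n / l n) := by
  refine PolyBdd.of_norm_le ha fun n => ?_
  rcases eq_or_ne (l n) 0 with h | h
  · simp [h]
  · have h1 : (1 : ℝ) ≤ |(l n : ℝ)| := by exact_mod_cast Int.one_le_abs h
    push_cast
    rw [norm_div, Complex.norm_intCast]
    exact div_le_self (norm_nonneg _) h1

lemma phi_add {a b : ℕ → ℚ} (ha : RatBdd a) (hb : RatBdd b) :
    phi (fun n => a n + b n) = phi a + phi b := by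
  funext u
  rw [Pi.add_apply, phi, phi, phi, ← psum_add ha.mul_bcoef hb.mul_bcoef (abs_xval_sq_lt_one u)]
  congr 1
  funext n
  push_cast
  ring

lemma phi_neg (a : ℕ → ℚ) : phi (fun n => -a n) = -phi a := by
  funext u
  rw [Pi.neg_apply, phi, phi, ← neg_one_mul, ← psum_const_mul]
  congr 1
  funext n
  push_cast
  ring

lemma phi_single (c : ℚ) : phi (fun n => if n = 0 then c else 0) = cst c := by
  funext u
  rw [phi, psum, tsum_eq_single 0 (fun n hn => by simp [hn])]
  simp [cst, bcoef_zero]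

lemma ratBdd_single (c : ℚ) : RatBdd (fun n => if n = 0 then c else 0) := by
  refine PolyBdd.of_norm_le (polyBdd_const c) fun n => ?_
  dsimp only
  split_ifs <;> simp

/-- The logarithmic derivative of `x`. -/
def dlogX : Fn := fun u => (1 - (u : ℂ) ^ 2) / ((u : ℂ) * (1 + (u : ℂ) ^ 2))

/-- The function `x`. -/
def sinF : Fn := fun u => (xval u : ℂ)

lemma one_add_sq_coe_ne_zero (u : Ioo (0 : ℝ) 1) : 1 + ((u : ℝ) : ℂ) ^ 2 ≠ 0 := by
  exact_mod_cast one_add_sq_ne_zero u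

lemma hasD_sinF : HasD sinF (dlogX * sinF) := by
  refine hasD_of_hasDerivAt (fun t => (xval t : ℂ)) (fun _ => rfl) fun u => ?_
  refine (hasDerivAt_xval u).ofReal_comp.congr_deriv ?_
  have h1 := one_add_sq_coe_ne_zero u
  have h2 := coe_ne_zero u
  simp only [dlogX, sinF, xval, Pi.mul_apply]
  push_cast
  field_simp

/-- The function `1 / x`. -/
def cscF : Fn := fun u => (1 + (u : ℂ) ^ 2) / (2 * (u : ℂ))

lemma sinF_mul_cscF : sinF * cscF = 1 := by
  funext u
  have h1 := one_add_sq_coe_ne_zero u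
  have h2 := coe_ne_zero u
  simp only [sinF, cscF, xval, Pi.mul_apply, Pi.one_apply]
  push_cast
  field_simp

lemma hasD_cscF : HasD cscF (-(dlogX * cscF)) := by
  have e : cscF = cst (1 / 2) * (pole 0 + X) := by
    funext u
    have h2 := coe_ne_zero u
    simp only [cscF, cst, pole, X, Pi.mul_apply, Pi.add_apply, sub_zero]
    field_simp
  have h : HasD cscF (fun u => 1 / 2 * (-(pole 0) ^ 2 + 1 : Fn) u) := by
    rw [e]
    exact ((hasD_pole (K := ⊥) zero_mem_poleSet).add hasD_X).const_mul _
  refine h.congr ?_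
  funext u
  have h1 := one_add_sq_coe_ne_zero u
  have h2 := coe_ne_zero u
  simp only [cscF, dlogX, pole, Pi.mul_apply, Pi.add_apply, Pi.neg_apply, Pi.pow_apply,
    Pi.one_apply, sub_zero]
  field_simp
  ring

lemma hasD_phi {a : ℕ → ℚ} (ha : RatBdd a) :
    HasD (phi a) (dlogX * phi (fun n => 2 * n * a n)) := by
  refine hasD_of_hasDerivAt (fun t => psum (fun n => (a n : ℂ) * bcoef n) (xval t ^ 2))
    (fun _ => rfl) fun u => ?_
  have hx := abs_xval_sq_lt_one u
  have h := (hasDerivAt_psum ha.mul_bcoef hx).scomp (u : ℝ) ((hasDerivAt_xval u).fun_pow 2)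
  refine h.congr_deriv ?_
  have hs := psum_shift ha.natCast_mul.mul_bcoef hx
  simp only [Nat.cast_zero, mul_zero, zero_mul, Rat.cast_zero, zero_add] at hs
  have e : (fun n : ℕ => ((2 * ((n + 1 : ℕ) : ℚ) * a (n + 1) : ℚ) : ℂ) * bcoef (n + 1)) =
      fun n : ℕ => 2 * (((n : ℂ) + 1) * ((a (n + 1) : ℂ) * bcoef (n + 1))) := by
    funext n
    push_cast
    ring
  rw [e, psum_const_mul] at hs
  rw [Pi.mul_apply, phi, hs, Complex.real_smul]
  have h1 := one_add_sq_coe_ne_zero u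
  have h2 := coe_ne_zero u
  simp only [dlogX, xval]
  push_cast
  field_simp

lemma tendsto_psum_xval {p : ℕ → ℂ} (hp : PolyBdd p) :
    Tendsto (fun u : Ioo (0 : ℝ) 1 => psum p (xval u ^ 2)) (nearEnd 0) (𝓝 (p 0)) := by
  have hx : xval 0 ^ 2 = 0 := by simp [xval]
  have hc : ContinuousAt (fun t => psum p (xval t ^ 2)) 0 := by
    refine ContinuousAt.comp (f := fun t => xval t ^ 2) (g := psum p) ?_
      (continuous_xval.pow 2).continuousAt
    exact continuousAt_psum hp (by rw [hx]; simp)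
  have := tendsto_nearEnd hc
  rwa [hx, psum_shift hp (by simp), Complex.ofReal_zero, zero_mul, add_zero] at this

lemma tendsto_phi {a : ℕ → ℚ} (ha : RatBdd a) : Tendsto (phi a) (nearEnd 0) (𝓝 (a 0)) := by
  have := tendsto_psum_xval ha.mul_bcoef
  rwa [bcoef_zero, mul_one] at this

lemma tendsto_sinF : Tendsto sinF (nearEnd 0) (𝓝 0) := by
  have := tendsto_nearEnd (e := 0) (Complex.continuous_ofReal.comp continuous_xval).continuousAt
  simp only [Function.comp_apply] at this
  rw [show xval 0 = 0 by simp [xval], Complex.ofReal_zero] at this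
  exact this

/-- Without its constant term the series is divisible by x², which outweighs the factor 1/x. -/
lemma tendsto_cscF_mul_phi {a : ℕ → ℚ} (ha : RatBdd a) (h0 : a 0 = 0) :
    Tendsto (cscF * phi a) (nearEnd 0) (𝓝 0) := by
  have h := tendsto_sinF.mul (tendsto_psum_xval ha.mul_bcoef.shift)
  rw [zero_mul] at h
  refine h.congr fun u => ?_
  have e := congrFun sinF_mul_cscF u
  simp only [Pi.mul_apply, Pi.one_apply] at e ⊢
  rw [phi, psum_shift ha.mul_bcoef (abs_xval_sq_lt_one u), h0]
  have : ((xval u ^ 2 : ℝ) : ℂ) = sinF u ^ 2 := by simp [sinF]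
  rw [this]
  linear_combination (-(sinF u) * psum (fun n => (a (n + 1) : ℂ) * bcoef (n + 1)) (xval u ^ 2)) * e

/-! ### Division of the coefficients by a linear factor. -/

lemma I_mem_poleSet (hI : Complex.I ∈ K) : Complex.I ∈ poleSet K :=
  ⟨hI, Or.inr ⟨by simp, fun h => by simpa using congrArg Complex.re h⟩⟩

lemma neg_I_mem_poleSet (hI : Complex.I ∈ K) : -Complex.I ∈ poleSet K :=
  ⟨neg_mem hI, Or.inr ⟨by simp, fun h => by simpa using congrArg Complex.re h⟩⟩

lemma neg_one_mem_poleSet : (-1 : ℂ) ∈ poleSet K :=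
  ⟨neg_mem K.one_mem, Or.inr ⟨by simp, by norm_num⟩⟩

/-- The function `1 / (1 + u²)`. -/
def invOneAddSq : Fn := fun u => (1 + (u : ℂ) ^ 2)⁻¹

lemma invOneAddSq_mem (hI : Complex.I ∈ K) : invOneAddSq ∈ regRing K := by
  have : invOneAddSq = pole Complex.I * pole (-Complex.I) := by
    funext u
    rw [invOneAddSq, Pi.mul_apply, pole, pole, ← mul_inv]
    congr 1
    linear_combination Complex.I_sq
  rw [this]
  exact mul_mem (pole_mem (I_mem_poleSet hI)) (pole_mem (neg_I_mem_poleSet hI))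

lemma sinF_mem (hI : Complex.I ∈ K) : sinF ∈ regRing K := by
  have : sinF = 2 * X * invOneAddSq := by
    funext u
    simp only [sinF, xval, X, invOneAddSq, Pi.mul_apply, Pi.ofNat_apply]
    push_cast
    ring
  rw [this]
  exact mul_mem (mul_mem (ofNat_mem _ 2) X_mem) (invOneAddSq_mem hI)

lemma cscF_mem : cscF ∈ regRing K := by
  have : cscF = cst (1 / 2) * (1 + X ^ 2) * pole 0 := by
    funext u
    have h2 := coe_ne_zero u
    simp only [cscF, cst, pole, X, Pi.mul_apply, Pi.add_apply, Pi.one_apply, Pi.pow_apply,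
      sub_zero]
    field_simp
  rw [this]
  exact mul_mem (mul_mem (cst_mem (div_mem K.one_mem (ofNat_mem K 2)))
    (add_mem (one_mem _) (pow_mem X_mem 2))) (pole_mem zero_mem_poleSet)

/-- The numerator 1 - u² of dx/x cancels the simple pole at 1. This is why a division leads from
`hspanPole` back to `hspanReg`. -/
lemma dlogX_mul_mem_hspan (hI : Complex.I ∈ K) {r f : Fn} (hr : r ∈ regRing K)
    (hf : f ∈ hspanPole K) : dlogX * r * f ∈ hspan K := by
  have : dlogX * r * f = (-(X + 1) * pole 0 * invOneAddSq * r) * ((X - 1) * f) := by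
    funext u
    have h1 := one_add_sq_coe_ne_zero u
    have h2 := coe_ne_zero u
    simp only [dlogX, pole, X, invOneAddSq, Pi.mul_apply, Pi.add_apply, Pi.one_apply,
      Pi.sub_apply, Pi.neg_apply, sub_zero]
    field_simp
    ring
  rw [this]
  refine mul_mem_hspan (mul_mem (mul_mem (mul_mem (neg_mem (add_mem X_mem (one_mem _)))
    (pole_mem zero_mem_poleSet)) (invOneAddSq_mem hI)) hr) hf

lemma phi_div_even_mem (hI : Complex.I ∈ K) {a : ℕ → ℚ} (ha : RatBdd a) (h0 : a 0 = 0)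
    (h : phi a ∈ hspanPole K) : phi (fun n => a n / (2 * (n : ℤ) : ℤ)) ∈ hspanReg K := by
  have hb := ha.div fun n => 2 * (n : ℤ)
  have e : (fun n : ℕ => 2 * (n : ℚ) * (a n / (2 * (n : ℤ) : ℤ))) = a := by
    funext n
    rcases n with _ | n
    · simp [h0]
    · push_cast; field_simp
  have hd := hasD_phi hb
  rw [e] at hd
  refine mem_hspanReg_of_hasD hd ?_ (tendsto_phi hb) (by simp)
  simpa using dlogX_mul_mem_hspan hI (one_mem _) h

/-- The Euler operator maps xφ_{a/(2n+1)} to xφ_a. -/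
lemma phi_div_odd_mem (hI : Complex.I ∈ K) {a : ℕ → ℚ} (ha : RatBdd a)
    (h : phi a ∈ hspanPole K) : phi (fun n => a n / (2 * (n : ℤ) + 1 : ℤ)) ∈ hspanReg K := by
  have hb := ha.div fun n => 2 * (n : ℤ) + 1
  have e : (fun n : ℕ => a n / (2 * (n : ℤ) + 1 : ℤ) + 2 * (n : ℚ) *
      (a n / (2 * (n : ℤ) + 1 : ℤ))) = a := by
    funext n
    have : (2 * (n : ℚ) + 1) ≠ 0 := by positivity
    push_cast
    field_simp
    ring
  have e' := phi_add hb hb.natCast_mul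
  rw [e] at e'
  have hd := (hasD_sinF.mul (hasD_phi hb)).congr (g' := dlogX * sinF * phi a) (by rw [e']; ring)
  have hm : sinF * phi (fun n => a n / (2 * (n : ℤ) + 1 : ℤ)) ∈ hspanReg K := by
    refine mem_hspanReg_of_hasD hd (dlogX_mul_mem_hspan hI (sinF_mem hI) h)
      (tendsto_sinF.mul (tendsto_phi hb)) ?_
    rw [zero_mul]
    exact K.zero_mem
  have := mul_mem_hspanReg cscF_mem hm
  rwa [← mul_assoc, mul_comm cscF, sinF_mul_cscF, one_mul] at this

/-- The Euler operator maps φ_{a/(2n-1)}/x to φ_a/x; the condition at n = 0 gives a finite limit at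
the origin. -/
lemma phi_div_odd_mem' (hI : Complex.I ∈ K) {a : ℕ → ℚ} (ha : RatBdd a) (h0 : a 0 = 0)
    (h : phi a ∈ hspanPole K) : phi (fun n => a n / (2 * (n : ℤ) - 1 : ℤ)) ∈ hspanReg K := by
  have hb := ha.div fun n => 2 * (n : ℤ) - 1
  have e : (fun n : ℕ => -(a n / (2 * (n : ℤ) - 1 : ℤ)) + 2 * (n : ℚ) *
      (a n / (2 * (n : ℤ) - 1 : ℤ))) = a := by
    funext n
    have : (2 * (n : ℚ) - 1) ≠ 0 := by
      have : (2 * (n : ℤ) - 1) ≠ 0 := by omega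
      exact_mod_cast this
    push_cast
    field_simp
    ring
  have e' := phi_add hb.neg hb.natCast_mul
  rw [e, phi_neg] at e'
  have hd := (hasD_cscF.mul (hasD_phi hb)).congr (g' := dlogX * cscF * phi a) (by rw [e']; ring)
  have hm : cscF * phi (fun n => a n / (2 * (n : ℤ) - 1 : ℤ)) ∈ hspanReg K :=
    mem_hspanReg_of_hasD hd (dlogX_mul_mem_hspan hI cscF_mem h)
      (tendsto_cscF_mul_phi hb (by simp [h0])) K.zero_mem
  have := mul_mem_hspanReg (sinF_mem hI) hm
  rwa [← mul_assoc, sinF_mul_cscF, one_mul] at this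

/-- The three kinds of linear denominators. -/
def IsLin (l : ℕ → ℤ) : Prop :=
  (∀ n : ℕ, l n = 2 * (n : ℤ)) ∨ (∀ n : ℕ, l n = 2 * (n : ℤ) + 1) ∨ (∀ n : ℕ, l n = 2 * (n : ℤ) - 1)

lemma ratCast_mem_field (c : ℚ) : (c : ℂ) ∈ K := SubfieldClass.ratCast_mem K c

lemma phi_div_mem (hI : Complex.I ∈ K) {a : ℕ → ℚ} (ha : RatBdd a) {l : ℕ → ℤ} (hl : IsLin l)
    (h : phi a ∈ hspanPole K) : phi (fun n => a n / l n) ∈ hspanReg K := by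
  -- The term n = 0 is removed because two of the three cases need it to vanish. It returns at the
  -- end as a rational constant, also when `l 0 = 0`, where the quotient is 0.
  set a' : ℕ → ℚ := fun n => a n + if n = 0 then -a 0 else 0 with ha'
  have hb : RatBdd a' := ha.add (ratBdd_single _)
  have h0 : a' 0 = 0 := by simp [ha']
  have hp : phi a' ∈ hspanPole K := by
    rw [ha', phi_add ha (ratBdd_single _), phi_single]
    exact add_mem h (hspan_le_hspanPole (hspanReg_le_hspan (cst_mem_hspanReg
      (ratCast_mem_field _))))
  have hm : phi (fun n => a' n / l n) ∈ hspanReg K := by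
    rcases hl with hl | hl | hl
    · simp_rw [hl]; exact phi_div_even_mem hI hb h0 hp
    · simp_rw [hl]; exact phi_div_odd_mem hI hb hp
    · simp_rw [hl]; exact phi_div_odd_mem' hI hb h0 hp
  have e : (fun n => a n / l n) =
      fun n => a' n / l n + if n = 0 then a 0 / l 0 else 0 := by
    funext n
    rcases n with _ | n <;> simp [ha']
  rw [e, phi_add (hb.div l) (ratBdd_single _), phi_single]
  exact add_mem hm (cst_mem_hspanReg (ratCast_mem_field _))

/-! ### Passage to partial sums. -/

/-- The function `√(1 - x²) / x`. -/
def cotF : Fn := fun u => (1 - (u : ℂ) ^ 2) / (2 * (u : ℂ))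

lemma hasD_cotF : HasD cotF (fun u => -(1 + (u : ℂ) ^ 2) / (2 * (u : ℂ) ^ 2)) := by
  have e : cotF = cst (1 / 2) * (pole 0 - X) := by
    funext u
    have h2 := coe_ne_zero u
    simp only [cotF, cst, pole, X, Pi.mul_apply, Pi.sub_apply, sub_zero]
    field_simp
  have h : HasD cotF (fun u => 1 / 2 * (-(pole 0) ^ 2 - 1 : Fn) u) := by
    rw [e]
    exact ((hasD_pole (K := ⊥) zero_mem_poleSet).sub hasD_X).const_mul _
  refine h.congr ?_
  funext u
  have h2 := coe_ne_zero u
  simp only [pole, Pi.sub_apply, Pi.neg_apply, Pi.pow_apply, Pi.one_apply, sub_zero]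
  field_simp
  ring

/-- By `bcoef_succ`, (1 - 1/(2n+2)) b_{n+1} = x² b_n. Shifting the index replaces σ_n by σ_{n+1} =
σ_n + a_n, and the term n = 0 on the left vanishes as σ_0 = 0. -/
lemma phi_partialSum_relation {a : ℕ → ℚ} (ha : RatBdd a) (u : Ioo (0 : ℝ) 1) :
    phi (fun n => ∑ m ∈ Finset.range n, a m) u -
      phi (fun n => (∑ m ∈ Finset.range n, a m) / (2 * (n : ℤ) : ℤ)) u =
    (xval u : ℂ) ^ 2 * (phi (fun n => ∑ m ∈ Finset.range n, a m) u + phi a u) := by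
  have hσ := ha.partialSum
  have hg := hσ.div fun n => 2 * (n : ℤ)
  have hx := abs_xval_sq_lt_one u
  have e1 : phi (fun n => ∑ m ∈ Finset.range n, a m) u + phi a u =
      psum (fun n => ((∑ m ∈ Finset.range (n + 1), a m : ℚ) : ℂ) * bcoef n) (xval u ^ 2) := by
    rw [← Pi.add_apply, ← phi_add hσ ha, phi]
    simp_rw [Finset.sum_range_succ]
  have e2 := phi_add hσ hg.neg
  rw [phi_neg] at e2
  have e3 := congrFun e2 u
  rw [phi, psum_shift (hσ.add hg.neg).mul_bcoef hx] at e3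
  rw [e1, sub_eq_add_neg, ← Pi.neg_apply, ← Pi.add_apply, ← e3]
  simp only [Finset.range_zero, Finset.sum_empty, zero_div, neg_zero, add_zero, Rat.cast_zero,
    zero_mul, zero_add]
  push_cast
  congr 2
  funext n
  have hn : ((n : ℂ) + 1) ≠ 0 := by exact_mod_cast n.succ_ne_zero
  field_simp
  linear_combination (∑ m ∈ Finset.range (n + 1), (a m : ℂ)) * bcoef_succ n

/-- The relation above is a linear differential equation for g = φ_{σ/2n}, because θg = φ_σ; its
integrating factor is `cotF`. Dividing by `cotF` at the end creates the pole at u = 1. -/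
lemma phi_partialSum_div_even_mem (hI : Complex.I ∈ K) {a : ℕ → ℚ} (ha : RatBdd a)
    (h : phi a ∈ hspanPole K) :
    phi (fun n => (∑ m ∈ Finset.range n, a m) / (2 * (n : ℤ) : ℤ)) ∈ hspanPole K := by
  have hσ := ha.partialSum
  have hg := hσ.div fun n => 2 * (n : ℤ)
  set g : ℕ → ℚ := fun n => (∑ m ∈ Finset.range n, a m) / (2 * (n : ℤ) : ℤ) with hgdef
  have e : (fun n : ℕ => 2 * (n : ℚ) * g n) = fun n => ∑ m ∈ Finset.range n, a m := by
    funext n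
    rcases n with _ | n
    · simp
    · simp only [hgdef]; push_cast; field_simp
  have hd := hasD_phi hg
  rw [e] at hd
  have hD : HasD (cotF * phi g) (2 * invOneAddSq * phi a) := by
    refine (hasD_cotF.mul hd).congr ?_
    funext u
    have rel := phi_partialSum_relation ha u
    have h1 := one_add_sq_coe_ne_zero u
    have h2 := coe_ne_zero u
    simp only [xval] at rel
    push_cast at rel
    simp only [cotF, dlogX, invOneAddSq, Pi.mul_apply, Pi.add_apply, Pi.ofNat_apply]
    field_simp at rel ⊢
    simp only [hgdef]
    push_cast
    linear_combination rel
  have hlim : Tendsto (cotF * phi g) (nearEnd 0) (𝓝 0) := by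
    have h1 : Tendsto (fun u : Ioo (0 : ℝ) 1 => (((1 - (u : ℝ) ^ 2) / (1 + (u : ℝ) ^ 2) : ℝ) : ℂ))
        (nearEnd 0) (𝓝 _) :=
      tendsto_nearEnd (F := fun u : ℝ => (((1 - u ^ 2) / (1 + u ^ 2) : ℝ) : ℂ))
        (Complex.continuous_ofReal.comp ((by fun_prop : Continuous fun u : ℝ => 1 - u ^ 2).div
          (by fun_prop) one_add_sq_ne_zero)).continuousAt
    have h2 := h1.mul (tendsto_cscF_mul_phi hg (by simp [hgdef]))
    rw [mul_zero] at h2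
    refine h2.congr fun u => ?_
    have h1 := one_add_sq_coe_ne_zero u
    have h2 := coe_ne_zero u
    simp only [cotF, cscF, Pi.mul_apply]
    push_cast
    field_simp
  have hm : cotF * phi g ∈ hspan K :=
    mem_hspan_of_hasD hD (mul_mem_hspanPole (mul_mem (ofNat_mem _ 2) (invOneAddSq_mem hI)) h)
      hlim K.zero_mem
  rw [mem_hspanPole]
  -- 1/`cotF` = 2u/((1-u)(1+u)): after multiplication by u - 1 only the admissible pole at -1 is
  -- left.
  have e2 : (X - 1) * phi g = (-2 * X * pole (-1)) * (cotF * phi g) := by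
    funext u
    have h2 := coe_ne_zero u
    have h3 : ((u : ℝ) : ℂ) + 1 ≠ 0 := by
      have : (u : ℝ) + 1 ≠ 0 := by linarith [u.2.1]
      exact_mod_cast this
    simp only [cotF, pole, X, Pi.mul_apply, Pi.sub_apply, Pi.neg_apply,
      Pi.ofNat_apply, sub_neg_eq_add]
    field_simp
    ring
  rw [e2]
  exact mul_mem_hspan (mul_mem (mul_mem (neg_mem (ofNat_mem _ 2)) X_mem)
    (pole_mem neg_one_mem_poleSet)) hm

/-- 1/(2n±1) = 1/(2n) ∓ 1/(2n(2n±1)) reduces to the even case followed by an ordinary division. At n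
= 0 the partial sum is empty. -/
lemma phi_partialSum_div_mem (hI : Complex.I ∈ K) {a : ℕ → ℚ} (ha : RatBdd a) {l : ℕ → ℤ}
    (hl : IsLin l) (h : phi a ∈ hspanPole K) :
    phi (fun n => (∑ m ∈ Finset.range n, a m) / l n) ∈ hspanPole K := by
  have hm := phi_partialSum_div_even_mem hI ha h
  have hg := ha.partialSum.div fun n => 2 * (n : ℤ)
  have hm' := hspan_le_hspanPole (hspanReg_le_hspan (phi_div_mem hI hg hl hm))
  rcases hl with hl | hl | hl
  · simp_rw [hl]; exact hm
  · have e : (fun n => (∑ m ∈ Finset.range n, a m) / l n) = fun n =>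
        (∑ m ∈ Finset.range n, a m) / (2 * (n : ℤ) : ℤ) +
          -((∑ m ∈ Finset.range n, a m) / (2 * (n : ℤ) : ℤ) / l n) := by
      funext n
      rcases n with _ | n
      · simp
      · have : (2 * ((n + 1 : ℕ) : ℚ) + 1) ≠ 0 := by positivity
        have : ((n + 1 : ℕ) : ℚ) ≠ 0 := by positivity
        rw [hl]
        generalize (n + 1 : ℕ) = k at *
        push_cast
        field_simp
        ring
    rw [e, phi_add hg (hg.div l).neg, phi_neg]
    exact add_mem hm (neg_mem hm')
  · have e : (fun n => (∑ m ∈ Finset.range n, a m) / l n) = fun n =>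
        (∑ m ∈ Finset.range n, a m) / (2 * (n : ℤ) : ℤ) +
          (∑ m ∈ Finset.range n, a m) / (2 * (n : ℤ) : ℤ) / l n := by
      funext n
      rcases n with _ | n
      · simp
      · have : (2 * ((n + 1 : ℕ) : ℚ) - 1) ≠ 0 := by
          have : (2 * ((n + 1 : ℕ) : ℤ) - 1) ≠ 0 := by omega
          exact_mod_cast this
        have : ((n + 1 : ℕ) : ℚ) ≠ 0 := by positivity
        rw [hl]
        generalize (n + 1 : ℕ) = k at *
        push_cast
        field_simp
        ring
    rw [e, phi_add hg (hg.div l)]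
    exact add_mem hm hm'

/-! ### The nested sums. -/

open Classical in
/-- The inner sums of the Apéry-type series, as a function of the outermost index. -/
def alpha : (d : ℕ) → (Fin d → ℕ) → (Fin d → ℕ → ℤ) → (Fin d → Prop) → ℕ → ℚ
  -- The delta at 0 stands for the terminal 0 of the chain, so that n_d ≻ 0 is treated like the
  -- other relations.
  | 0, _, _, _, n => if n = 0 then 1 else 0
  | d + 1, s, l, strict, n =>
    (∑ m ∈ Finset.range (if strict 0 then n else n + 1),
      alpha d (Fin.tail s) (Fin.tail l) (Fin.tail strict) m) / (l 0 n : ℚ) ^ s 0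

lemma phi_iterate_mem (hI : Complex.I ∈ K) {a : ℕ → ℚ} {l : ℕ → ℤ} (hl : IsLin l)
    (ha : RatBdd (fun n => a n / l n)) (h : phi (fun n => a n / l n) ∈ hspanPole K) (k : ℕ) :
    RatBdd (fun n => a n / (l n : ℚ) ^ (k + 1)) ∧
      phi (fun n => a n / (l n : ℚ) ^ (k + 1)) ∈ hspanPole K ∧
      (0 < k → phi (fun n => a n / (l n : ℚ) ^ (k + 1)) ∈ hspanReg K) := by
  induction k with
  | zero => simpa using ⟨ha, h⟩
  | succ k ih =>
    have e : (fun n => a n / (l n : ℚ) ^ (k + 1 + 1)) =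
        fun n => a n / (l n : ℚ) ^ (k + 1) / l n := by
      funext n
      rw [div_div, ← pow_succ]
    have hm := phi_div_mem hI ih.1 hl ih.2.1
    rw [e]
    exact ⟨ih.1.div l, hspan_le_hspanPole (hspanReg_le_hspan hm), fun _ => hm⟩

/-- A relation ≥ adds the diagonal term a_n to the partial sum. The first division gives only
`hspanPole`, every further one gives `hspanReg`; hence the condition on `s 0`. -/
lemma phi_alpha_succ_mem (hI : Complex.I ∈ K) {d : ℕ} (s : Fin (d + 1) → ℕ) (hs : ∀ j, 0 < s j)
    (l : Fin (d + 1) → ℕ → ℤ) (hl : ∀ j, IsLin (l j)) (strict : Fin (d + 1) → Prop)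
    (ha : RatBdd (alpha d (Fin.tail s) (Fin.tail l) (Fin.tail strict)))
    (h : phi (alpha d (Fin.tail s) (Fin.tail l) (Fin.tail strict)) ∈ hspanPole K) :
    RatBdd (alpha (d + 1) s l strict) ∧ phi (alpha (d + 1) s l strict) ∈ hspanPole K ∧
      (2 ≤ s 0 → phi (alpha (d + 1) s l strict) ∈ hspanReg K) := by
  set a := alpha d (Fin.tail s) (Fin.tail l) (Fin.tail strict) with hadef
  obtain ⟨k, hk⟩ := Nat.exists_eq_succ_of_ne_zero (hs 0).ne'
  have hm := phi_partialSum_div_mem hI ha (hl 0) h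
  by_cases hst : strict 0
  · have e : alpha (d + 1) s l strict =
        fun n => (∑ m ∈ Finset.range n, a m) / (l 0 n : ℚ) ^ (k + 1) := by
      funext n
      rw [alpha, if_pos hst, hk]
    rw [e, hk]
    have := phi_iterate_mem hI (hl 0) (ha.partialSum.div (l 0)) hm k
    exact ⟨this.1, this.2.1, fun h => this.2.2 (by omega)⟩
  · have e : alpha (d + 1) s l strict =
        fun n => (∑ m ∈ Finset.range n, a m + a n) / (l 0 n : ℚ) ^ (k + 1) := by
      funext n
      rw [alpha, if_neg hst, hk, Finset.sum_range_succ]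
    have hm' := hspan_le_hspanPole (hspanReg_le_hspan (phi_div_mem hI ha (hl 0) h))
    have hm2 := add_mem hm hm'
    rw [← phi_add (ha.partialSum.div _) (ha.div _)] at hm2
    simp_rw [← add_div] at hm2
    rw [e, hk]
    have := phi_iterate_mem hI (hl 0) ((ha.partialSum.add ha).div (l 0)) hm2 k
    exact ⟨this.1, this.2.1, fun h => this.2.2 (by omega)⟩

lemma phi_alpha_mem (hI : Complex.I ∈ K) (d : ℕ) (s : Fin d → ℕ) (hs : ∀ j, 0 < s j)
    (l : Fin d → ℕ → ℤ) (hl : ∀ j, IsLin (l j)) (strict : Fin d → Prop) :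
    RatBdd (alpha d s l strict) ∧ phi (alpha d s l strict) ∈ hspanPole K := by
  induction d with
  | zero =>
    have e : alpha 0 s l strict = fun n => if n = 0 then 1 else 0 := by
      funext n; rw [alpha]
    rw [e, phi_single]
    exact ⟨ratBdd_single 1, hspan_le_hspanPole (hspanReg_le_hspan (cst_mem_hspanReg
      (ratCast_mem_field _)))⟩
  | succ d ih =>
    have := ih (Fin.tail s) (fun j => hs _) (Fin.tail l) (fun j => hl _) (Fin.tail strict)
    have h := phi_alpha_succ_mem hI s hs l hl strict this.1 this.2
    exact ⟨h.1, h.2.1⟩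

/-! ### Hyperlogarithms as multiple polylogarithms. -/

lemma strictAnti_cons {d a : ℕ} {f : Fin d → ℕ} (hf : StrictAnti f) (h : ∀ j, f j < a) :
    StrictAnti (Fin.cons a f : Fin (d + 1) → ℕ) := by
  intro i j hij
  induction i using Fin.cases with
  | zero =>
    induction j using Fin.cases with
    | zero => exact absurd hij (lt_irrefl _)
    | succ j => simpa using h j
  | succ i =>
    induction j using Fin.cases with
    | zero => exact absurd hij (Fin.not_lt_zero _)
    | succ j => simpa using hf (Fin.succ_lt_succ_iff.1 hij)

lemma mplPartialSum_cons {r : ℕ} (s0 : ℕ) (z0 : ℂ) (s : Fin r → ℕ) (z : Fin r → ℂ) (N : ℕ) :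
    mplPartialSum (Fin.cons s0 s : Fin (r + 1) → ℕ) (Fin.cons z0 z : Fin (r + 1) → ℂ) N =
      ∑ n ∈ Finset.Ioo 0 N, z0 ^ n / (n : ℂ) ^ s0 * mplPartialSum s z n := by
  classical
  simp_rw [mplPartialSum, Finset.mul_sum]
  rw [Finset.sum_sigma']
  refine Finset.sum_bij' (fun n _ => ⟨n 0, Fin.tail n⟩) (fun p _ => Fin.cons p.1 p.2)
    ?_ ?_ ?_ ?_ ?_
  · intro n hn
    simp only [Finset.mem_filter, Fintype.mem_piFinset, Finset.mem_Ioo, Finset.mem_sigma] at hn ⊢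
    exact ⟨hn.1 0, fun j => ⟨(hn.1 j.succ).1, hn.2 (Fin.succ_pos j)⟩,
      fun i j hij => hn.2 (Fin.succ_lt_succ_iff.2 hij)⟩
  · intro p hp
    simp only [Finset.mem_filter, Fintype.mem_piFinset, Finset.mem_Ioo, Finset.mem_sigma] at hp ⊢
    refine ⟨fun j => ?_, strictAnti_cons hp.2.2 fun j => (hp.2.1 j).2⟩
    induction j using Fin.cases with
    | zero => simpa using hp.1
    | succ j => simpa using ⟨(hp.2.1 j).1, (hp.2.1 j).2.trans hp.1.2⟩
  · intro n _
    exact Fin.cons_self_tail n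
  · intro p _
    simp
  · intro n _
    rw [Fin.prod_univ_succ]
    simp [Fin.tail]

lemma mplPartialSum_fin_zero (s : Fin 0 → ℕ) (z : Fin 0 → ℂ) (N : ℕ) :
    mplPartialSum s z N = 1 := by
  classical
  rw [mplPartialSum, Finset.filter_true_of_mem fun n _ i => i.elim0]
  simp

lemma prod_Iic_cons_succ {r : ℕ} (z0 : ℂ) (z : Fin r → ℂ) (j : Fin r) :
    ∏ i ∈ Finset.Iic j.succ, (Fin.cons z0 z : Fin (r + 1) → ℂ) i =
      z0 * ∏ i ∈ Finset.Iic j, z i := by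
  have e : ∀ {n : ℕ} (f : Fin n → ℂ) (j : Fin n),
      ∏ i ∈ Finset.Iic j, f i = ∏ i, if i ≤ j then f i else 1 := by
    intro n f j
    rw [← Finset.prod_filter]
    congr 1
    ext i
    simp
  rw [e, e, Fin.prod_univ_succ]
  simp

/-- A hyperlogarithm is a multiple polylogarithm. -/
lemma exists_mpl_of_isWord (hK : ∀ a ∈ K, IsAlgebraic ℚ a) {w : List (ℕ × ℂ)} (hw : IsWord K w)
    {y : ℂ} (hy : IsAlgebraic ℚ y) : ∃ (r : ℕ) (s : Fin r → ℕ) (z : Fin r → ℂ),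
      (∀ j, 0 < s j) ∧ (∀ j, ∃ a : ℂ, ‖a‖ = 1 ∧ ∏ i ∈ Finset.Iic j, z i = y / a) ∧
      (∀ j, IsAlgebraic ℚ (z j)) ∧
      (∀ h : 0 < r, s ⟨0, h⟩ = 1 → z ⟨0, h⟩ = 1 → ∃ a v, ‖a‖ = 1 ∧ w = (0, a) :: v ∧ y = a) ∧
      ∀ N, 0 < N → mplPartialSum s z N = ∑ n ∈ Finset.range N, hcoef w n * y ^ n := by
  induction w generalizing y with
  | nil =>
    refine ⟨0, Fin.elim0, Fin.elim0, fun j => j.elim0, fun j => j.elim0, fun j => j.elim0,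
      fun h => absurd h (lt_irrefl _), fun N hN => ?_⟩
    rw [mplPartialSum_fin_zero, Finset.sum_eq_single_of_mem 0 (Finset.mem_range.2 hN)
      (fun n _ hn => by simp [hcoef, hn])]
    simp [hcoef]
  | cons q w ih =>
    obtain ⟨k, a⟩ := q
    have ha := hw (k, a) (by simp)
    simp only at ha
    have ha0 : a ≠ 0 := by rintro rfl; simp at ha
    -- The arguments are y/a₁, a₁/a₂, …, whose products telescope to y/a_j; the inner word is
    -- therefore evaluated at y = a.
    obtain ⟨r, s, z, hs, hz, halg, -, hsum⟩ := ih hw.tail (hK a ha.1)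
    refine ⟨r + 1, Fin.cons (k + 1) s, Fin.cons (y / a) z, fun j => ?_, fun j => ?_, fun j => ?_,
      fun h h1 h2 => ?_, fun N hN => ?_⟩
    · induction j using Fin.cases with
      | zero => simp
      | succ j => simpa using hs j
    · induction j using Fin.cases with
      | zero =>
        refine ⟨a, ha.2, ?_⟩
        have : Finset.Iic (0 : Fin (r + 1)) = {0} := by
          ext i; simp
        rw [this, Finset.prod_singleton, Fin.cons_zero]
      | succ j =>
        obtain ⟨b, hb, hp⟩ := hz j
        refine ⟨b, hb, ?_⟩
        rw [prod_Iic_cons_succ, hp]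
        field_simp
    · induction j using Fin.cases with
      | zero =>
        rw [Fin.cons_zero, div_eq_mul_inv]
        exact hy.mul (hK a ha.1).inv
      | succ j => simpa using halg j
    · have h1' : k + 1 = 1 := h1
      have h2' : y / a = 1 := h2
      obtain rfl : k = 0 := by omega
      exact ⟨a, w, ha.2, rfl, (div_eq_one_iff_eq ha0).1 h2'⟩
    · rw [mplPartialSum_cons]
      have e : Finset.range N = insert 0 (Finset.Ioo 0 N) := by
        ext n; simp; omega
      rw [e, Finset.sum_insert (by simp), hcoef_cons_zero, zero_mul, zero_add]
      refine Finset.sum_congr rfl fun n hn => ?_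
      rw [hsum n (Finset.mem_Ioo.1 hn).1, hcoef, div_pow, inv_pow]
      ring

lemma hlog_mem_values (hK : ∀ a ∈ K, IsAlgebraic ℚ a) {w : List (ℕ × ℂ)} (hw : IsWord K w)
    {u : Ioo (0 : ℝ) 1} (hu : ((u : ℝ) : ℂ) ∈ K) : hlog w u ∈ mplAlgebraicValues := by
  obtain ⟨r, s, z, hs, hz, halg, hone, hsum⟩ := exists_mpl_of_isWord hK hw (hK _ hu)
  refine ⟨r, s, z, ⟨hs, fun j => ?_, fun h h' => ?_⟩, halg, ?_⟩
  · obtain ⟨a, ha, hp⟩ := hz j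
    rw [hp, norm_div, ha, div_one, Complex.norm_real]
    exact (abs_coe_lt_one u).le
  · obtain ⟨a, v, ha, -, hua⟩ := hone h h'.1 h'.2
    exact coe_ne_of_norm_eq_one u ha hua
  · refine ((polyBdd_hcoef hw).hasSum (abs_coe_lt_one u)).tendsto_sum_nat.congr' ?_
    filter_upwards [eventually_gt_atTop 0] with N hN
    exact (hsum N hN).symm

/-! ### Limits at u = 1. -/

lemma sum_inv_sqrt_le (n : ℕ) : ∑ m ∈ Finset.range n, 1 / √((m : ℝ) + 1) ≤ 2 * √(n : ℝ) := by
  induction n with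
  | zero => simp
  | succ n ih =>
    rw [Finset.sum_range_succ]
    push_cast
    have hx : 0 < √((n : ℝ) + 1) := Real.sqrt_pos.2 (by positivity)
    have hy : 0 ≤ √(n : ℝ) := Real.sqrt_nonneg _
    have h1 : √((n : ℝ) + 1) ^ 2 = n + 1 := Real.sq_sqrt (by positivity)
    have h2 : √(n : ℝ) ^ 2 = n := Real.sq_sqrt (by positivity)
    have h3 : 1 / √((n : ℝ) + 1) ≤ 2 * √((n : ℝ) + 1) - 2 * √(n : ℝ) := by
      rw [div_le_iff₀ hx]
      nlinarith [sq_nonneg (√((n : ℝ) + 1) - √(n : ℝ))]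
    linarith

lemma norm_sum_hcoef_le {w : List (ℕ × ℂ)} {C : ℝ} (hC : ∀ n, ‖hcoef w n‖ ≤ C / √((n : ℝ) + 1))
    {a : ℂ} (ha : ‖a‖ = 1) (n : ℕ) :
    ‖∑ m ∈ Finset.range n, hcoef w m * a ^ m‖ ≤ 2 * C * √(n : ℝ) := by
  have hC0 : 0 ≤ C := by simpa using (norm_nonneg _).trans (hC 0)
  calc ‖∑ m ∈ Finset.range n, hcoef w m * a ^ m‖
      ≤ ∑ m ∈ Finset.range n, C * (1 / √((m : ℝ) + 1)) := by
        refine norm_sum_le_of_le _ fun m _ => ?_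
        rw [norm_mul, norm_pow, ha, one_pow, mul_one, mul_one_div]
        exact hC m
    _ = C * ∑ m ∈ Finset.range n, 1 / √((m : ℝ) + 1) := by rw [Finset.mul_sum]
    _ ≤ C * (2 * √(n : ℝ)) := by gcongr; exact sum_inv_sqrt_le n
    _ = _ := by ring

/-- The bound n^(-1/2) reproduces itself: its partial sums are O(√n), and the next letter divides by
at least n. It absorbs the powers of log n that really occur. -/
lemma exists_norm_hcoef_le {w : List (ℕ × ℂ)} (hw : IsWord K w) :
    ∃ C : ℝ, ∀ n, ‖hcoef w n‖ ≤ C / √((n : ℝ) + 1) := by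
  induction w with
  | nil =>
    refine ⟨1, fun n => ?_⟩
    rcases n with _ | n
    · simp [hcoef]
    · simp [hcoef]
  | cons q w ih =>
    obtain ⟨C, hC⟩ := ih hw.tail
    have hC0 : 0 ≤ C := by simpa using (norm_nonneg _).trans (hC 0)
    have hq := (hw q (by simp)).2
    -- One factor 2 comes from `sum_inv_sqrt_le`, the other from √(n+1) ≤ 2√n.
    refine ⟨4 * C, fun n => ?_⟩
    rcases n.eq_zero_or_pos with rfl | hn
    · simp [hcoef_cons_zero, hC0]
    have hn' : (1 : ℝ) ≤ n := by exact_mod_cast hn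
    rw [hcoef, norm_div, norm_mul, norm_pow, norm_inv, hq, inv_one, one_pow, mul_one, norm_pow,
      Complex.norm_natCast, div_le_div_iff₀ (by positivity) (by positivity)]
    have h1 : √((n : ℝ) + 1) ≤ 2 * √(n : ℝ) := by
      rw [Real.sqrt_le_left (by positivity), mul_pow, Real.sq_sqrt (by positivity)]
      linarith
    have h2 : (n : ℝ) ≤ (n : ℝ) ^ (q.1 + 1) := le_self_pow₀ hn' (by omega)
    have h3 : √(n : ℝ) * √(n : ℝ) = n := Real.mul_self_sqrt (by positivity)
    calc _ ≤ (2 * C * √(n : ℝ)) * (2 * √(n : ℝ)) :=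
          mul_le_mul (norm_sum_hcoef_le hC hq n) h1 (by positivity) (by positivity)
      _ = 4 * C * n := by linear_combination (4 * C) * h3
      _ ≤ _ := by gcongr

lemma summable_sqrt_div_sq : Summable fun n : ℕ => √(n : ℝ) / (n : ℝ) ^ 2 := by
  refine (Real.summable_one_div_nat_rpow.2 (by norm_num : (1 : ℝ) < 3 / 2)).congr fun n => ?_
  rcases n.eq_zero_or_pos with rfl | hn
  · norm_num
  have hn' : (0 : ℝ) < n := by exact_mod_cast hn
  rw [Real.sqrt_eq_rpow, ← Real.rpow_natCast, ← Real.rpow_sub hn', one_div, ← Real.rpow_neg hn'.le]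
  norm_num

lemma tendsto_const_div_sqrt (C : ℝ) :
    Tendsto (fun n : ℕ => C / √((n : ℝ) + 1)) atTop (𝓝 0) := by
  refine Tendsto.const_div_atTop ?_ C
  exact Real.tendsto_sqrt_atTop.comp
    (tendsto_atTop_add_const_right _ _ tendsto_natCast_atTop_atTop)

lemma tendsto_hcoef_zero {w : List (ℕ × ℂ)} (hw : IsWord K w) :
    Tendsto (hcoef w) atTop (𝓝 0) := by
  obtain ⟨C, hC⟩ := exists_norm_hcoef_le hw
  exact squeeze_zero_norm hC (tendsto_const_div_sqrt C)

/-- Summation by parts against the powers of a number other than `1`. -/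
lemma one_sub_mul_sum_mul_pow (d : ℕ → ℂ) (b : ℂ) (N : ℕ) :
    (1 - b) * ∑ n ∈ Finset.range N, d n * b ^ n =
      d 0 - d N * b ^ N + ∑ n ∈ Finset.range N, (d (n + 1) - d n) * b ^ (n + 1) := by
  induction N with
  | zero => simp
  | succ N ih =>
    rw [Finset.sum_range_succ, mul_add, ih, Finset.sum_range_succ]
    ring

/-- If the first exponent is at least 2, the coefficients are O(n^(-3/2)). Otherwise the first
letter a is not 1, and summation by parts against the powers of a⁻¹ leaves differences of size
O(n^(-3/2)). -/
lemma exists_tendsto_sum_hcoef {w : List (ℕ × ℂ)} (hw : IsWord K w)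
    (hw1 : ∀ v, w ≠ (0, 1) :: v) :
    ∃ L, Tendsto (fun N => ∑ n ∈ Finset.range N, hcoef w n) atTop (𝓝 L) := by
  rcases w with _ | ⟨⟨k, a⟩, w⟩
  · have h : HasSum (hcoef []) _ := hasSum_single 0 (fun n hn => by simp [hcoef, hn])
    exact ⟨_, h.tendsto_sum_nat⟩
  obtain ⟨C, hC⟩ := exists_norm_hcoef_le hw.tail
  have hC0 : 0 ≤ C := by simpa using (norm_nonneg _).trans (hC 0)
  have ha := (hw (k, a) (by simp)).2
  simp only at ha
  have hA := norm_sum_hcoef_le hC ha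
  set A : ℕ → ℂ := fun n => ∑ m ∈ Finset.range n, hcoef w m * a ^ m with hAdef
  rcases k with _ | k
  · have ha1 : a⁻¹ ≠ 1 := by
      intro h
      rw [inv_eq_one] at h
      exact hw1 w (by rw [h])
    set d : ℕ → ℂ := fun n => A n / n with hd
    -- 5C = C + 4C, from the bounds `b1` and `b2` on the two parts of the difference.
    have hdiff : Summable fun n => (d (n + 1) - d n) * a⁻¹ ^ (n + 1) := by
      refine Summable.of_norm_bounded (g := fun n : ℕ => 5 * C *
        (√((n + 1 : ℕ) : ℝ) / ((n + 1 : ℕ) : ℝ) ^ 2))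
        (((summable_nat_add_iff 1).2 summable_sqrt_div_sq).mul_left _) fun n => ?_
      rw [norm_mul, norm_pow, norm_inv, ha, inv_one, one_pow, mul_one]
      have e : d (n + 1) - d n = hcoef w n * a ^ n / (n + 1) - A n / (n * (n + 1)) := by
        have hA1 : A (n + 1) = A n + hcoef w n * a ^ n := Finset.sum_range_succ _ _
        rcases n.eq_zero_or_pos with rfl | hn
        · simp [hd, hAdef]
        · have h1 : (n : ℂ) ≠ 0 := by exact_mod_cast hn.ne'
          have h2 : ((n : ℂ) + 1) ≠ 0 := by exact_mod_cast n.succ_ne_zero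
          simp only [hd, hA1]
          push_cast
          field_simp
          ring
      rw [e]
      have hn0 : (0 : ℝ) ≤ n := n.cast_nonneg
      have hx : 0 < √((n : ℝ) + 1) := Real.sqrt_pos.2 (by positivity)
      have hx2 : √((n : ℝ) + 1) * √((n : ℝ) + 1) = n + 1 := Real.mul_self_sqrt (by positivity)
      have b1 : ‖hcoef w n * a ^ n / ((n : ℂ) + 1)‖ ≤
          C * (√((n : ℝ) + 1) / ((n : ℝ) + 1) ^ 2) := by
        have e1 : ‖(n : ℂ) + 1‖ = (n : ℝ) + 1 := by
          rw [← Nat.cast_succ, Complex.norm_natCast]; push_cast; ring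
        rw [norm_div, norm_mul, norm_pow, ha, one_pow, mul_one, e1]
        calc ‖hcoef w n‖ / ((n : ℝ) + 1) ≤ C / √((n : ℝ) + 1) / ((n : ℝ) + 1) := by
              gcongr; exact hC n
          _ = _ := by
              field_simp
              linear_combination (-C) * hx2
      have b2 : ‖A n / ((n : ℂ) * (n + 1))‖ ≤
          4 * C * (√((n : ℝ) + 1) / ((n : ℝ) + 1) ^ 2) := by
        rcases n.eq_zero_or_pos with rfl | hn
        · simp; positivity
        have hn1 : (1 : ℝ) ≤ n := by exact_mod_cast hn
        have e1 : ‖(n : ℂ) + 1‖ = (n : ℝ) + 1 := by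
          rw [← Nat.cast_succ, Complex.norm_natCast]; push_cast; ring
        rw [norm_div, norm_mul, e1, Complex.norm_natCast, ← mul_div_assoc,
          div_le_div_iff₀ (by positivity) (by positivity)]
        calc ‖A n‖ * ((n : ℝ) + 1) ^ 2
            ≤ (2 * C * √((n : ℝ) + 1)) * (2 * (n * ((n : ℝ) + 1))) := by
              refine mul_le_mul ((hA n).trans ?_) (by nlinarith) (by positivity) (by positivity)
              gcongr
              linarith
          _ = _ := by ring
      push_cast
      refine (norm_sub_le _ _).trans ?_
      linarith
    have hd0 : Tendsto (fun N => d N * a⁻¹ ^ N) atTop (𝓝 0) := by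
      refine squeeze_zero_norm (a := fun N : ℕ => 4 * C / √((N : ℝ) + 1)) (fun N => ?_)
        (tendsto_const_div_sqrt _)
      have e : d N * a⁻¹ ^ N = hcoef ((0, a) :: w) N := by
        simp only [hd, hAdef, hcoef, zero_add, pow_one]
        ring
      rw [e]
      rcases N.eq_zero_or_pos with rfl | hn
      · simp [hcoef_cons_zero, hC0]
      have hn' : (1 : ℝ) ≤ N := by exact_mod_cast hn
      have h1 : √((N : ℝ) + 1) ≤ 2 * √(N : ℝ) := by
        rw [Real.sqrt_le_left (by positivity), mul_pow, Real.sq_sqrt (by positivity)]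
        linarith
      have h3 : √(N : ℝ) * √(N : ℝ) = N := Real.mul_self_sqrt (by positivity)
      rw [← e, norm_mul, norm_pow, norm_inv, ha, inv_one, one_pow, mul_one, norm_div,
        Complex.norm_natCast, div_le_div_iff₀ (by positivity) (by positivity)]
      calc _ ≤ (2 * C * √(N : ℝ)) * (2 * √(N : ℝ)) :=
            mul_le_mul (hA N) h1 (by positivity) (by positivity)
        _ = 4 * C * N := by linear_combination (4 * C) * h3
    have h1b : (1 - a⁻¹) ≠ 0 := sub_ne_zero.2 ha1.symm
    refine ⟨_, (((tendsto_const_nhds (x := d 0)).sub hd0).add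
      hdiff.hasSum.tendsto_sum_nat |>.const_mul (1 - a⁻¹)⁻¹).congr fun N => ?_⟩
    rw [← one_sub_mul_sum_mul_pow, inv_mul_cancel_left₀ h1b]
    refine Finset.sum_congr rfl fun n _ => ?_
    simp only [hd, hAdef, hcoef, zero_add, pow_one]
    ring
  · have hsum : Summable (hcoef ((k + 1, a) :: w)) := by
      refine Summable.of_norm_bounded (summable_sqrt_div_sq.mul_left (2 * C)) fun n => ?_
      rcases n.eq_zero_or_pos with rfl | hn
      · simp [hcoef_cons_zero]
      have hn' : (1 : ℝ) ≤ n := by exact_mod_cast hn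
      rw [hcoef, norm_div, norm_mul, norm_pow, norm_inv, ha, inv_one, one_pow, mul_one, norm_pow,
        Complex.norm_natCast, ← mul_div_assoc]
      refine div_le_div₀ (by positivity) (hA n) (by positivity) ?_
      exact pow_le_pow_right₀ hn' (by omega)
    exact ⟨_, hsum.hasSum.tendsto_sum_nat⟩

lemma tendsto_psum_nearEnd_one {p : ℕ → ℂ} {L : ℂ}
    (h : Tendsto (fun N => ∑ n ∈ Finset.range N, p n) atTop (𝓝 L)) :
    Tendsto (fun u : Ioo (0 : ℝ) 1 => psum p u) (nearEnd 1) (𝓝 L) := by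
  have := Complex.tendsto_tsum_powerSeries_nhdsWithin_lt h
  rw [tendsto_map'_iff] at this
  exact this.comp ((tendsto_coe_nearEnd 1).mono_right (nhdsWithin_mono _ Ioo_subset_Iio_self))

/-- The coefficient sums of (u-1)·`hlog w` telescope to -`hcoef w N`, which tends to 0; Abel's
theorem concludes. -/
lemma tendsto_sub_one_mul_hlog {w : List (ℕ × ℂ)} (hw : IsWord K w) :
    Tendsto ((X - 1) * hlog w) (nearEnd 1) (𝓝 0) := by
  set q : ℕ → ℂ := fun n => if n = 0 then 0 else hcoef w (n - 1) with hq
  have hqb : PolyBdd q := by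
    refine ⟨1, 0, fun n => ?_⟩
    simp only [hq]
    split_ifs
    · simp
    · simpa using norm_hcoef_le hw _
  have hs : ∀ N, ∑ n ∈ Finset.range (N + 1), (q n + -1 * hcoef w n) = -hcoef w N := by
    intro N
    induction N with
    | zero => simp [hq]
    | succ N ih =>
      rw [Finset.sum_range_succ, ih]
      simp [hq]
  have hlim : Tendsto (fun N => ∑ n ∈ Finset.range N, (q n + -1 * hcoef w n)) atTop (𝓝 0) := by
    rw [← tendsto_add_atTop_iff_nat 1]
    simp_rw [hs]
    simpa using (tendsto_hcoef_zero hw).neg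
  refine (tendsto_psum_nearEnd_one hlim).congr fun u => ?_
  have hu := abs_coe_lt_one u
  rw [psum_add hqb ((polyBdd_const (-1)).mul (polyBdd_hcoef hw)) hu, psum_const_mul,
    psum_shift hqb hu]
  simp only [hq, Nat.add_sub_cancel, if_true, Nat.add_eq_zero_iff, one_ne_zero, and_false, if_false,
    Pi.mul_apply, Pi.sub_apply, Pi.one_apply, X, hlog]
  ring

lemma exists_tendsto_regRing {r : Fn} (hr : r ∈ regRing K) :
    ∃ c ∈ K, Tendsto r (nearEnd 1) (𝓝 c) := by
  induction hr using Algebra.adjoin_induction with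
  | mem x hx =>
    have hX : Tendsto X (nearEnd 1) (𝓝 1) := by
      simpa only [Complex.ofReal_one] using tendsto_X_nearEnd 1
    rcases hx with rfl | ⟨p, hp, rfl⟩
    · exact ⟨1, K.one_mem, hX⟩
    · have h1 : 1 - p ≠ 0 := by
        rcases hp.2 with rfl | h
        · simp
        · exact sub_ne_zero.2 h.2.symm
      exact ⟨(1 - p)⁻¹, inv_mem (sub_mem K.one_mem hp.1), (hX.sub_const p).inv₀ h1⟩
  | algebraMap c => exact ⟨c, c.2, tendsto_const_nhds⟩
  | add x y _ _ hx hy =>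
    obtain ⟨c, hc, h⟩ := hx
    obtain ⟨c', hc', h'⟩ := hy
    exact ⟨_, add_mem hc hc', h.add h'⟩
  | mul x y _ _ hx hy =>
    obtain ⟨c, hc, h⟩ := hx
    obtain ⟨c', hc', h'⟩ := hy
    exact ⟨_, mul_mem hc hc', h.mul h'⟩

lemma apply_mem_of_mem_regRing {r : Fn} (hr : r ∈ regRing K) {u : Ioo (0 : ℝ) 1}
    (hu : ((u : ℝ) : ℂ) ∈ K) : r u ∈ K := by
  induction hr using Algebra.adjoin_induction with
  | mem x hx =>
    rcases hx with rfl | ⟨p, hp, rfl⟩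
    · exact hu
    · exact inv_mem (sub_mem hu hp.1)
  | algebraMap c => exact c.2
  | add x y _ _ hx hy => exact add_mem hx hy
  | mul x y _ _ hx hy => exact mul_mem hx hy

lemma mul_mem_span_values {c v : ℂ} (hc : c ∈ K) {S : Set ℂ} (hv : v ∈ Submodule.span K S) :
    c * v ∈ Submodule.span K S := Submodule.smul_mem _ (⟨c, hc⟩ : K) hv

lemma apply_mem_span_of_mem_hspan (hK : ∀ a ∈ K, IsAlgebraic ℚ a) {f : Fn} (hf : f ∈ hspan K)
    {u : Ioo (0 : ℝ) 1} (hu : ((u : ℝ) : ℂ) ∈ K) :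
    f u ∈ Submodule.span K mplAlgebraicValues := by
  induction hf using Submodule.span_induction with
  | zero => exact zero_mem _
  | add x y _ _ hx hy => exact add_mem hx hy
  | smul c x _ hx => exact Submodule.smul_mem _ c hx
  | mem x hx =>
    obtain ⟨r, hr, w, hw, rfl⟩ := hx
    exact mul_mem_span_values (apply_mem_of_mem_regRing hr hu)
      (Submodule.subset_span (hlog_mem_values hK hw hu))

lemma apply_mem_span_of_mem_hspanPole (hK : ∀ a ∈ K, IsAlgebraic ℚ a) {f : Fn}
    (hf : f ∈ hspanPole K) {u : Ioo (0 : ℝ) 1} (hu : ((u : ℝ) : ℂ) ∈ K) :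
    f u ∈ Submodule.span K mplAlgebraicValues := by
  have h := apply_mem_span_of_mem_hspan hK (mem_hspanPole.1 hf) hu
  have h1 : ((u : ℝ) : ℂ) - 1 ≠ 0 := sub_ne_zero.2 (coe_ne_of_norm_eq_one u (by simp))
  have h2 := mul_mem_span_values (inv_mem (sub_mem hu K.one_mem)) h
  simpa [X, h1] using h2

/-- For a word not starting with the letter 1, Abel's theorem identifies the limit with the series
at 1, a polylogarithm whose first pair is not (1, 1). The other words are killed by the factor u -
1. -/
lemma exists_tendsto_of_mem_hspanReg (hK : ∀ a ∈ K, IsAlgebraic ℚ a) {f : Fn}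
    (hf : f ∈ hspanReg K) :
    ∃ v ∈ Submodule.span K mplAlgebraicValues, Tendsto f (nearEnd 1) (𝓝 v) := by
  induction hf using Submodule.span_induction with
  | zero => exact ⟨0, zero_mem _, tendsto_const_nhds⟩
  | add x y _ _ hx hy =>
    obtain ⟨v, hv, h⟩ := hx
    obtain ⟨v', hv', h'⟩ := hy
    exact ⟨_, add_mem hv hv', h.add h'⟩
  | smul c x _ hx =>
    obtain ⟨v, hv, h⟩ := hx
    exact ⟨_, Submodule.smul_mem _ c hv, h.const_mul (c : ℂ)⟩
  | mem x hx =>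
    rcases hx with ⟨r, hr, w, hw, hw1, rfl⟩ | ⟨r, hr, w, hw, rfl⟩
    · obtain ⟨c, hc, h⟩ := exists_tendsto_regRing hr
      obtain ⟨L, hL⟩ := exists_tendsto_sum_hcoef hw hw1
      refine ⟨c * L, mul_mem_span_values hc (Submodule.subset_span ?_),
        h.mul (tendsto_psum_nearEnd_one hL)⟩
      obtain ⟨r, s, z, hs, hz, halg, hone, hsum⟩ :=
        exists_mpl_of_isWord hK hw (y := 1) isAlgebraic_one
      refine ⟨r, s, z, ⟨hs, fun j => ?_, fun h h' => ?_⟩, halg, ?_⟩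
      · obtain ⟨a, ha, hp⟩ := hz j
        rw [hp, norm_div, ha, div_one, norm_one]
      · obtain ⟨a, v, ha, hwv, rfl⟩ := hone h h'.1 h'.2
        exact hw1 v hwv
      · refine hL.congr' ?_
        filter_upwards [eventually_gt_atTop 0] with N hN
        rw [hsum N hN]
        simp
    · obtain ⟨c, hc, h⟩ := exists_tendsto_regRing hr
      refine ⟨0, zero_mem _, ?_⟩
      have := h.mul (tendsto_sub_one_mul_hlog hw)
      rw [mul_zero] at this
      exact this.congr fun u => by simp only [Pi.mul_apply]; ring

/-! ### Regrouping the multiple series by its outermost index. -/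

/-- The outermost index of a chain, `0` for the empty chain. -/
def headIndex {d : ℕ} (n : Fin d → ℕ) : ℕ := if h : 0 < d then n ⟨0, h⟩ else 0

lemma nextIndex_cons_zero {d : ℕ} (N : ℕ) (n : Fin d → ℕ) :
    nextIndex (Fin.cons N n : Fin (d + 1) → ℕ) 0 = headIndex n := by
  simp only [nextIndex, headIndex, Fin.val_zero, zero_add, Nat.lt_add_left_iff_pos]
  split_ifs <;> rfl

lemma nextIndex_cons_succ {d : ℕ} (N : ℕ) (n : Fin d → ℕ) (j : Fin d) :
    nextIndex (Fin.cons N n : Fin (d + 1) → ℕ) j.succ = nextIndex n j := by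
  simp only [nextIndex, Fin.val_succ, add_lt_add_iff_right]
  split_ifs <;> rfl

lemma cons_mem_indexSet {d : ℕ} {strict : Fin (d + 1) → Prop} {N : ℕ} {n : Fin d → ℕ} :
    (Fin.cons N n : Fin (d + 1) → ℕ) ∈ indexSet strict ↔
      (headIndex n ≤ N ∧ (strict 0 → headIndex n < N)) ∧ n ∈ indexSet (Fin.tail strict) := by
  simp only [indexSet, Set.mem_ofPred_eq, Fin.forall_fin_succ, nextIndex_cons_zero,
    nextIndex_cons_succ, Fin.cons_zero, Fin.cons_succ, Fin.tail]

open Classical in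
/-- The chains with prescribed outermost index. -/
def chains : (d : ℕ) → (Fin d → Prop) → ℕ → Finset (Fin d → ℕ)
  | 0, _, N => if N = 0 then {Fin.elim0} else ∅
  | d + 1, strict, N =>
    (Finset.range (if strict 0 then N else N + 1)).biUnion fun m =>
      (chains d (Fin.tail strict) m).image fun n => (Fin.cons N n : Fin (d + 1) → ℕ)

lemma mem_chains {d : ℕ} {strict : Fin d → Prop} {N : ℕ} {n : Fin d → ℕ} :
    n ∈ chains d strict N ↔ n ∈ indexSet strict ∧ headIndex n = N := by
  classical
  induction d generalizing N with
  | zero =>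
    have h1 : n ∈ indexSet strict := fun j => j.elim0
    have h2 : headIndex n = 0 := by simp [headIndex]
    have h3 : n = Fin.elim0 := Subsingleton.elim _ _
    rw [chains]
    split_ifs with h
    · exact iff_of_true (Finset.mem_singleton.2 h3) ⟨h1, h2.trans h.symm⟩
    · simp [h2, Ne.symm h]
  | succ d ih =>
    have hh : headIndex n = n 0 := by simp [headIndex]
    rw [chains, Finset.mem_biUnion, hh]
    constructor
    · rintro ⟨m, hm, hn⟩
      obtain ⟨n', hn', rfl⟩ := Finset.mem_image.1 hn
      obtain ⟨h1, h2⟩ := ih.1 hn'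
      refine ⟨cons_mem_indexSet.2 ⟨?_, h1⟩, Fin.cons_zero _ _⟩
      rw [h2]
      rw [Finset.mem_range] at hm
      split_ifs at hm with hs
      · exact ⟨hm.le, fun _ => hm⟩
      · exact ⟨by omega, fun h => absurd h hs⟩
    · rintro ⟨hn, rfl⟩
      rw [← Fin.cons_self_tail n] at hn
      obtain ⟨h1, h2⟩ := cons_mem_indexSet.1 hn
      refine ⟨headIndex (Fin.tail n), ?_, Finset.mem_image.2 ⟨Fin.tail n, ih.2 ⟨h2, rfl⟩,
        Fin.cons_self_tail n⟩⟩
      rw [Finset.mem_range]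
      split_ifs with hs
      · exact h1.2 hs
      · exact Nat.lt_succ_of_le h1.1

lemma alpha_eq_sum_chains {d : ℕ} (s : Fin d → ℕ) (l : Fin d → ℕ → ℤ) (strict : Fin d → Prop)
    (N : ℕ) : alpha d s l strict N =
      ∑ n ∈ chains d strict N, (∏ j, (l j (n j) : ℚ) ^ s j)⁻¹ := by
  classical
  induction d generalizing N with
  | zero =>
    rw [alpha, chains]
    split_ifs <;> simp
  | succ d ih =>
    rw [alpha, chains, Finset.sum_biUnion, Finset.sum_div]
    · refine Finset.sum_congr rfl fun m _ => ?_
      rw [ih, Finset.sum_image fun a _ b _ h => (Fin.cons_injective2 h).2, Finset.sum_div]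
      refine Finset.sum_congr rfl fun n _ => ?_
      rw [Fin.prod_univ_succ, mul_inv, div_eq_mul_inv, mul_comm]
      simp [Fin.tail]
    · intro m _ m' _ hne
      rw [Function.onFun, Finset.disjoint_left]
      rintro _ h h'
      obtain ⟨n, hn, rfl⟩ := Finset.mem_image.1 h
      obtain ⟨n', hn', e⟩ := Finset.mem_image.1 h'
      have : n' = n := (Fin.cons_injective2 e).2
      rw [this] at hn'
      exact hne ((mem_chains.1 hn).2.symm.trans (mem_chains.1 hn').2)

/-- Summation over the fibres of `headIndex`, each of which meets the range in the finite set
`chains`. -/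
lemma hasSum_xi {d : ℕ} [NeZero d] {s : Fin d → ℕ} {l : Fin d → ℕ → ℤ} {strict : Fin d → Prop}
    {x : ℝ} (h : Summable fun n : indexSet strict => xiTerm s l x n) :
    HasSum (fun N => b N x * (alpha d s l strict N : ℝ)) (xi s l strict x) := by
  have hs : HasSum ((indexSet strict).indicator (xiTerm s l x)) (xi s l strict x) :=
    hasSum_subtype_iff_indicator.1 h.hasSum
  have key : ∀ N, b N x * (alpha d s l strict N : ℝ) =
      ∑' n : (headIndex ⁻¹' {N} : Set (Fin d → ℕ)), (indexSet strict).indicator (xiTerm s l x) n.1 := by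
    intro N
    rw [tsum_subtype (headIndex ⁻¹' {N}) ((indexSet strict).indicator (xiTerm s l x)),
      tsum_eq_sum (s := chains d strict N), alpha_eq_sum_chains]
    · push_cast
      rw [Finset.mul_sum]
      refine Finset.sum_congr rfl fun n hn => ?_
      obtain ⟨h1, h2⟩ := mem_chains.1 hn
      have h3 : n 0 = N := by
        rw [← h2, headIndex, dif_pos (NeZero.pos d)]
        rfl
      rw [indicator_of_mem (by exact h2), indicator_of_mem h1, xiTerm, h3, div_eq_mul_inv]
    · intro n hn
      by_cases h2 : n ∈ headIndex ⁻¹' {N}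
      · rw [indicator_of_mem h2, indicator_of_notMem fun h1 => hn (mem_chains.2 ⟨h1, h2⟩)]
      · exact indicator_of_notMem h2 _
  simp_rw [key]
  exact hs.tsum_fiberwise headIndex

lemma xi_xval_eq_phi {d : ℕ} [NeZero d] {s : Fin d → ℕ} {l : Fin d → ℕ → ℤ}
    {strict : Fin d → Prop} {u : Ioo (0 : ℝ) 1}
    (h : Summable fun n : indexSet strict => xiTerm s l (xval u) n) :
    ((xi s l strict (xval u) : ℝ) : ℂ) = phi (alpha d s l strict) u := by
  rw [← (hasSum_xi h).tsum_eq, Complex.ofReal_tsum, phi, psum]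
  refine tsum_congr fun N => ?_
  rw [b, bcoef, pow_mul]
  push_cast
  ring

/-! ### The end point x = 1. -/

lemma b_mono {n : ℕ} {x : ℝ} (h0 : 0 ≤ x) (h1 : x ≤ 1) : |b n x| ≤ |b n 1| := by
  have hb : 0 ≤ 4 ^ n / (n.centralBinom : ℝ) := by positivity
  rw [b, b, abs_of_nonneg (by positivity), abs_of_nonneg (by positivity)]
  gcongr

lemma norm_xiTerm_le {d : ℕ} [NeZero d] (s : Fin d → ℕ) (l : Fin d → ℕ → ℤ) {x : ℝ}
    (h0 : 0 ≤ x) (h1 : x ≤ 1) (n : Fin d → ℕ) : ‖xiTerm s l x n‖ ≤ ‖xiTerm s l 1 n‖ := by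
  rw [xiTerm, xiTerm, norm_div, norm_div]
  gcongr
  exact b_mono h0 h1

lemma xval_one : xval 1 = 1 := by norm_num [xval]

/-- Dominated convergence: every term is largest in absolute value at x = 1, where the family is
summable. -/
lemma tendsto_phi_alpha_one {d : ℕ} [NeZero d] {s : Fin d → ℕ} {l : Fin d → ℕ → ℤ}
    {strict : Fin d → Prop} (h : Summable fun n : indexSet strict => xiTerm s l 1 n) :
    Tendsto (phi (alpha d s l strict)) (nearEnd 1) (𝓝 ((xi s l strict 1 : ℝ) : ℂ)) := by
  have hle : ∀ u : Ioo (0 : ℝ) 1, ∀ n : indexSet strict,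
      ‖xiTerm s l (xval u) n‖ ≤ ‖xiTerm s l 1 n‖ := fun u n =>
    norm_xiTerm_le s l (xval_pos u).le (xval_lt_one u).le n
  have h1 : Tendsto (fun u : Ioo (0 : ℝ) 1 => xi s l strict (xval u)) (nearEnd 1)
      (𝓝 (xi s l strict 1)) := by
    refine tendsto_tsum_of_dominated_convergence h.norm (fun n => ?_)
      (Eventually.of_forall hle)
    have hc : Continuous fun t : ℝ => xiTerm s l (xval t) n := by
      unfold xiTerm b
      exact (((continuous_xval.pow _).const_mul _).div_const _)
    have := tendsto_nearEnd hc.continuousAt (e := 1)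
    rwa [xval_one] at this
  refine ((Complex.continuous_ofReal.tendsto _).comp h1).congr fun u => ?_
  exact xi_xval_eq_phi (Summable.of_norm_bounded h.norm (hle u))

lemma one_le_b_one (n : ℕ) : 1 ≤ b n 1 := by
  have h1 : (0 : ℝ) < n.centralBinom := by exact_mod_cast n.centralBinom_pos
  rw [b, one_pow, mul_one, one_le_div h1]
  exact_mod_cast n.centralBinom_le_four_pow

/-- At `x = 1` the series with a simple outermost denominator diverges. -/
lemma two_le_of_summable_one {e : ℕ} {s : Fin (e + 1) → ℕ} (hs : ∀ j, 0 < s j)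
    {l : Fin (e + 1) → ℕ → ℤ} (hl : ∀ j, IsLin (l j)) {strict : Fin (e + 1) → Prop}
    (hne : ∀ n ∈ indexSet strict, ∀ j, l j (n j) ≠ 0)
    (hsum : Summable fun n : indexSet strict => xiTerm s l 1 n) : 2 ≤ s 0 := by
  by_contra hlt
  have hs0 : s 0 = 1 := by have := hs 0; omega
  -- The chains (e+1+k, e, …, 2, 1) are strictly decreasing and thus admissible for any choice of
  -- relations; only the outermost index varies.
  set ν : ℕ → Fin (e + 1) → ℕ := fun k => Fin.cons (e + 1 + k) fun j : Fin e => e - j with hν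
  have hlt : ∀ k j, nextIndex (ν k) j < ν k j := by
    intro k j
    have hval : ∀ (i : ℕ) (hi : i < e + 1), ν k ⟨i, hi⟩ = if i = 0 then e + 1 + k else e + 1 - i := by
      intro i hi
      rcases i with _ | i
      · rfl
      · rw [if_neg i.succ_ne_zero, Nat.add_sub_add_right]
        rfl
    obtain ⟨i, hi⟩ := j
    rw [nextIndex, hval]
    split_ifs with h1 h2 h2
    · rw [hval]; simp; omega
    · rw [hval]; simp; omega
    · omega
    · omega
  have hmem : ∀ k, ν k ∈ indexSet strict := fun k j => ⟨(hlt k j).le, fun _ => hlt k j⟩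
  have hinj : Function.Injective fun k => (⟨ν k, hmem k⟩ : indexSet strict) := by
    intro k k' h
    have h0 : ν k 0 = ν k' 0 := congrFun (congrArg Subtype.val h) 0
    simp only [hν, Fin.cons_zero] at h0
    omega
  have h1 := hsum.comp_injective hinj
  set P : ℝ := ∏ j : Fin e, (l j.succ (e - j) : ℝ) ^ s j.succ with hP
  have hP0 : P ≠ 0 := by
    refine Finset.prod_ne_zero_iff.2 fun j _ => pow_ne_zero _ ?_
    have := hne _ (hmem 0) j.succ
    simp only [hν, Fin.cons_succ] at this
    exact_mod_cast this
  have h2 : Summable fun k => b (e + 1 + k) 1 / (l 0 (e + 1 + k) : ℝ) := by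
    refine (h1.mul_right P).congr fun k => ?_
    simp only [Function.comp_apply, xiTerm]
    rw [Fin.prod_univ_succ, hs0, pow_one]
    simp only [hν, Fin.cons_zero, Fin.cons_succ]
    rw [← hP]
    field_simp
  -- With n = e+1+k, b_n(1) ≥ 1 and |l₁(n)| ≤ 2(n+1), so the harmonic series would converge.
  have h3 : Summable fun k : ℕ => 1 / ((k + (e + 2) : ℕ) : ℝ) := by
    refine Summable.of_nonneg_of_le (fun k => by positivity) (fun k => ?_) (h2.norm.mul_left 2)
    have hl0 : (l 0 (e + 1 + k) : ℝ) ≠ 0 := by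
      have := hne _ (hmem k) 0
      simp only [hν, Fin.cons_zero] at this
      exact_mod_cast this
    have hle : |(l 0 (e + 1 + k) : ℝ)| ≤ 2 * ((k + (e + 2) : ℕ) : ℝ) := by
      have : |l 0 (e + 1 + k)| ≤ 2 * ((k + (e + 2) : ℕ) : ℤ) := by
        rcases hl 0 with h | h | h <;> rw [h, abs_le] <;> push_cast <;> constructor <;> omega
      exact_mod_cast this
    rw [norm_div, Real.norm_eq_abs, Real.norm_eq_abs, ← mul_div_assoc,
      div_le_div_iff₀ (by positivity) (abs_pos.2 hl0), one_mul]
    have hb := (one_le_b_one (e + 1 + k)).trans (le_abs_self _)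
    have hk : (0 : ℝ) ≤ ((k + (e + 2) : ℕ) : ℝ) := Nat.cast_nonneg _
    nlinarith
  exact Real.not_summable_one_div_natCast
    ((summable_nat_add_iff (f := fun k : ℕ => 1 / (k : ℝ)) (e + 2)).1 h3)

/-! ### Return to x and to the coefficient ring. -/

/-- The inverse of the substitution `x = 2u / (1 + u²)`. -/
lemma exists_xval_eq {x : ℝ} (h0 : 0 < x) (h1 : x < 1) :
    ∃ u : Ioo (0 : ℝ) 1, (u : ℝ) = (1 - √(1 - x ^ 2)) / x ∧ xval u = x := by
  have hnn : 0 ≤ 1 - x ^ 2 := by nlinarith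
  have hc := Real.sq_sqrt hnn
  -- For x = sin t and c = cos t, the preimage (1-c)/x is tan(t/2).
  set c := √(1 - x ^ 2) with hcdef
  have hc0 : 0 ≤ c := Real.sqrt_nonneg _
  have hc1 : c < 1 := by nlinarith
  have hcx : 1 - c < x := by nlinarith
  refine ⟨⟨(1 - c) / x, div_pos (by linarith) h0, (div_lt_one h0).2 hcx⟩, rfl, ?_⟩
  have h2 : 1 + ((1 - c) / x) ^ 2 ≠ 0 := one_add_sq_ne_zero _
  simp only [xval]
  rw [div_eq_iff h2]
  field_simp
  linear_combination -hc

/-- The coefficient field. -/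
def coeffField (x : ℝ) : IntermediateField ℚ ℂ :=
  IntermediateField.adjoin ℚ {Complex.I, (x : ℂ), ((√(1 - x ^ 2) : ℝ) : ℂ)}

lemma isAlgebraic_ofReal {x : ℝ} (hx : IsAlgebraic ℚ x) : IsAlgebraic ℚ (x : ℂ) :=
  hx.algebraMap (A := ℂ)

lemma isAlgebraic_generators {x : ℝ} (hx : IsAlgebraic ℚ x) :
    ∀ y ∈ ({Complex.I, (x : ℂ), ((√(1 - x ^ 2) : ℝ) : ℂ)} : Set ℂ), IsAlgebraic ℚ y := by
  rintro y (rfl | rfl | rfl)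
  · refine IsAlgebraic.of_pow (n := 2) two_pos ?_
    rw [Complex.I_sq]
    exact isAlgebraic_one.neg
  · exact isAlgebraic_ofReal hx
  · refine isAlgebraic_ofReal ?_
    have h : IsAlgebraic ℚ (1 - x ^ 2) := isAlgebraic_one.sub (hx.pow 2)
    rcases le_or_gt 0 (1 - x ^ 2) with h0 | h0
    · refine IsAlgebraic.of_pow (n := 2) two_pos ?_
      rwa [Real.sq_sqrt h0]
    · rw [Real.sqrt_eq_zero_of_nonpos h0.le]
      exact isAlgebraic_zero

lemma isAlgebraic_of_mem_coeffField {x : ℝ} (hx : IsAlgebraic ℚ x) :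
    ∀ y ∈ coeffField x, IsAlgebraic ℚ y := by
  intro y hy
  have := IntermediateField.isAlgebraic_adjoin
    fun z hz => (isAlgebraic_generators hx z hz).isIntegral
  have h := this.isAlgebraic ⟨y, hy⟩
  exact h.algebraMap (A := ℂ)

/-- The generators are algebraic, so the ring they generate is already a field; inverting elements
of K in partial fractions costs nothing. -/
lemma span_coeffField_le {x : ℝ} (hx : IsAlgebraic ℚ x) {S : Set ℂ} {v : ℂ}
    (hv : v ∈ Submodule.span (coeffField x) S) : v ∈ Submodule.span (coeffRing x) S := by
  induction hv using Submodule.span_induction with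
  | zero => exact zero_mem _
  | add x y _ _ hx hy => exact add_mem hx hy
  | mem x hx => exact Submodule.subset_span hx
  | smul c y _ hy =>
    have hc : (c : ℂ) ∈ coeffRing x := by
      rw [coeffRing, ← IntermediateField.adjoin_toSubalgebra_of_isAlgebraic
        (isAlgebraic_generators hx)]
      exact c.2
    exact Submodule.smul_mem _ (⟨c, hc⟩ : coeffRing x) hy

end Apery

end

theorem mainTheorem7 (d : ℕ) [NeZero d] (s : Fin d → ℕ) (hs : ∀ j, 0 < s j)
    (l : Fin d → ℕ → ℤ)
    (hl : ∀ j, (∀ n : ℕ, l j n = 2 * (n : ℤ)) ∨ (∀ n : ℕ, l j n = 2 * (n : ℤ) + 1) ∨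
      (∀ n : ℕ, l j n = 2 * (n : ℤ) - 1))
    (strict : Fin d → Prop)
    (x : ℝ) (hx : IsAlgebraic ℚ x) (hx0 : 0 < x) (hx1 : x ≤ 1)
    (hex : Apery.XiExists s l strict x) :
    ((Apery.xi s l strict x : ℝ) : ℂ) ∈
      Submodule.span (Apery.coeffRing x) Apery.mplAlgebraicValues := by
  have hK := Apery.isAlgebraic_of_mem_coeffField hx
  have hI : Complex.I ∈ Apery.coeffField x :=
    IntermediateField.subset_adjoin ℚ _ (by simp)
  have hxK : (x : ℂ) ∈ Apery.coeffField x :=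
    IntermediateField.subset_adjoin ℚ _ (by simp)
  have hcK : ((Real.sqrt (1 - x ^ 2) : ℝ) : ℂ) ∈ Apery.coeffField x :=
    IntermediateField.subset_adjoin ℚ _ (by simp)
  refine Apery.span_coeffField_le hx ?_
  rcases hx1.lt_or_eq with hlt | rfl
  · obtain ⟨u, hu, hux⟩ := Apery.exists_xval_eq hx0 hlt
    have huK : ((u : ℝ) : ℂ) ∈ Apery.coeffField x := by
      rw [hu]
      push_cast
      exact div_mem (sub_mem (one_mem _) hcK) hxK
    have hm := (Apery.phi_alpha_mem hI d s hs l hl strict).2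
    have hsum := hex.2
    rw [← hux] at hsum
    have e := Apery.xi_xval_eq_phi hsum
    rw [hux] at e
    rw [e]
    exact Apery.apply_mem_span_of_mem_hspanPole hK hm huK
  -- Here u would be 1, outside the open interval, so the value is reached as a limit.
  · obtain ⟨e, rfl⟩ := Nat.exists_eq_succ_of_ne_zero (NeZero.ne d)
    have h2 := Apery.two_le_of_summable_one hs hl hex.1 hex.2
    have hm := Apery.phi_alpha_mem hI e (Fin.tail s) (fun j => hs _) (Fin.tail l) (fun j => hl _)
      (Fin.tail strict)
    have hreg := (Apery.phi_alpha_succ_mem hI s hs l hl strict hm.1 hm.2).2.2 h2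
    obtain ⟨v, hv, hlim⟩ := Apery.exists_tendsto_of_mem_hspanReg hK hreg
    rwa [tendsto_nhds_unique (Apery.tendsto_phi_alpha_one hex.2) hlim]
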